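/- \textbf{Setting.} Let $\hbar>0$, and let $A$ be a nondegenerate observable on a Hilbert space $\mathcal H_S$ of finite dimension $N\ge 2$, with orthonormal eigenbasis $\varphi_1,\dots,\varphi_N$, $A\varphi_k=a_k\varphi_k$, the real numbers $a_k$ being distinct; put $a_0=\min\{a_k-a_l : a_k>a_l\}$. The probe space is $L^2(\mathbb R,dq)$ with position $Q$ and momentum $P$; the pointer space is $L^2(\mathbb R,db)$, with pointer observable $B$ = multiplication by $b$. A function $\psi\in L^2(\mathbb R)$ is \emph{momentum limited of type} $\kappa>0$ if $\psi(x)=\int_{-\kappa}^{\kappa}e^{ixk}g(k)\,dk$ for all $x$, for some $g\in L^2$ supported in $[-\kappa,\kappa]$. For couplings $\alpha>0$, $\lambda>0$ put $\beta=2\lambda/\alpha$. The initial state is $\psi_0\otimes\Psi\otimes\Phi$ with unit vectors $\psi_0\in\mathcal H_S$, $\Psi\in L^2(\mathbb R,dq)$, $\Phi\in L^2(\mathbb R,db)$, where $\Psi$ is momentum limited of type $\kappa_0>0$ with momentum amplitude $\langle p|\Psi\rangle=\sqrt{2\pi/\hbar}\;g(p/\hbar)$ that is (a.e.) real and either even or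 odd, and $\Phi$ is momentum limited of type $b_0>0$. Define $$\rho_k=\int dp\,|\langle p|\Psi\rangle|^2\, e^{\frac i\hbar(\lambda a_k-p\beta)B}|\Phi\rangle\langle\Phi|e^{-\frac i\hbar(\lambda a_k-p\beta)B},\qquad F(\eta)=\int dp\,|\langle p|\Psi\rangle|^2e^{-\frac i\hbar p\beta\eta},$$ $$S_{kl}(b,b')=\int_{-\infty}^\infty db''\,e^{\frac i\hbar\lambda(a_l-a_k)b''}|\Phi(b'')|^2F(b'-b'')F(b''-b),$$ $$I_{kl}(b,b')=\int_{-\infty}^\infty dq\,e^{-\frac i\hbar\alpha q(a_k-a_l)}\,\Psi(q-\beta b)\,\overline{\Psi(q-\beta b')},$$ $$\lambda_0=\frac{2\hbar b_0}{a_0},\qquad \alpha_0=\frac{4\hbar\kappa_0}{a_0-2\hbar b_0/\lambda},\qquad \alpha_D=\frac{2\hbar\kappa_0}{a_0}.$$ Let $\rho_{S\otimes Po}$ be the partial trace over the probe of the pure state $U(\psi_0\otimes\Psi\otimes\Phi)$, where $$U=e^{\frac{i}{2\hbar}\alpha\beta A\otimes 1\otimes B}\,e^{-\frac i\hbar\alpha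 A\otimes Q\otimes 1}\,e^{-\frac i\hbar\beta\,1\otimes P\otimes B}.$$ \textbf{Claim.} (1) For $k\ne l$, $\rho_k\rho_l$ is the integral operator on $L^2(\mathbb R,db)$ with kernel $e^{\frac i\hbar\lambda(a_kb-a_lb')}\,\Phi(b)\overline{\Phi(b')}\,S_{kl}(b,b')$. (2) If $\lambda>\lambda_0$, then $\alpha_0>\alpha_D$. (3) If $\lambda>\lambda_0$ and $\alpha>\alpha_0$, then: (a) for all $k\neq l$, $S_{kl}(b,b')=0$ for all $b,b'$, and $\rho_k\rho_l=0$; (b) with $S_k=(\ker\rho_k)^\perp$ (the support of $\rho_k$) for $1\le k\le N$ and $S_0=\bigcap_k\ker\rho_k$, the subspaces $S_0,\dots,S_N$ are mutually orthogonal, $L^2(\mathbb R,db)=S_0\oplus S_1\oplus\dots\oplus S_N$, and there are orthogonal projections $\Pi_0,\dots,\Pi_N$ with ranges $S_0,\dots,S_N$ that form a projection-valued measure ($\Pi_j\Pi_k=0$ for $j\ne k$, $\sum_k\Pi_k=1$), with $\Pi_k\rho_k=\rho_k$ for $k\geq 1$ and $\Pi_j\rho_k=0$ for $j\ne k$; (c)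 decoherence is exact: $\alpha>\alpha_D$, $I_{kl}(b,b')=0$ for all $k\ne l$ and all $b,b'$, and $\rho_{S\otimes Po}=\sum_k|\langle\varphi_k|\psi_0\rangle|^2\,|\varphi_k\rangle\langle\varphi_k|\otimes\rho_k$. -/

import Mathlib

open MeasureTheory

noncomputable section

/-- The (square integrable) wave function `ψ` is momentum limited of type `κ`, with spectral
amplitude `g ∈ L²(ℝ)` supported in `[-κ, κ]`: `ψ(x) = ∫_{-κ}^{κ} e^{i x k} g(k) dk`. -/
def HasSpectralAmplitude (κ : ℝ) (ψ g : ℝ → ℂ) : Prop :=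
  MemLp ψ 2 volume ∧ MemLp g 2 volume ∧ (∀ k : ℝ, κ < |k| → g k = 0) ∧
    ∀ x : ℝ, ψ x = ∫ k in (-κ)..κ, Complex.exp (Complex.I * x * k) * g k

/-- `ψ` is momentum limited of type `κ`. -/
def IsMomentumLimited (κ : ℝ) (ψ : ℝ → ℂ) : Prop :=
  ∃ g : ℝ → ℂ, HasSpectralAmplitude κ ψ g

/-- The normalised momentum representation `⟨p|ψ⟩`, `p = ħ k`, of a wave function with spectral
amplitude `g`, so that `ψ(q) = (2πħ)^{-1/2} ∫ e^{i p q / ħ} ⟨p|ψ⟩ dp`. -/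
def momentumAmplitude (hbar : ℝ) (g : ℝ → ℂ) (p : ℝ) : ℂ :=
  (Real.sqrt (2 * Real.pi / hbar) : ℂ) * g (p / hbar)

/-- The pointer Hilbert space `L²(ℝ)`, in the representation in which the pointer observable `B`
(simple spectrum `ℝ`) is multiplication by the variable `b`. -/
abbrev PointerSpace : Type := Lp ℂ 2 (volume : Measure ℝ)

open Classical in
/-- The vector of `L²(ℝ)` given by a square integrable function (zero for other functions). -/
def toL2 (f : ℝ → ℂ) : PointerSpace :=
  if h : MemLp f 2 (volume : Measure ℝ) then h.toLp f else 0

/-- The strength `β = 2λ/α` of the probe-pointer coupling. -/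
def couplingBeta (alpha lam : ℝ) : ℝ := 2 * lam / alpha

/-- The vector `e^{i s B} |Φ⟩` of the pointer space. -/
def expB (s : ℝ) (Φ : ℝ → ℂ) : PointerSpace :=
  toL2 fun b => Complex.exp (Complex.I * s * b) * Φ b

/-- The pointer state that goes with the eigenvalue `x` of the measured observable,
`∫ dp |⟨p|Ψ⟩|² e^{(i/ħ)(λ x - p β) B} |Φ⟩⟨Φ| e^{-(i/ħ)(λ x - p β) B}`,
where `χ p = ⟨p|Ψ⟩` is the probe momentum amplitude and `β = 2λ/α`. -/
def pointerState (hbar alpha lam : ℝ) (χ Φ : ℝ → ℂ) (x : ℝ) :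
    PointerSpace →L[ℂ] PointerSpace :=
  ∫ p : ℝ, ((‖χ p‖ ^ 2 : ℝ) : ℂ) •
    InnerProductSpace.rankOne ℂ
      (expB ((lam * x - p * couplingBeta alpha lam) / hbar) Φ)
      (expB ((lam * x - p * couplingBeta alpha lam) / hbar) Φ)

/-- `F(η) = ∫ dp |⟨p|Ψ⟩|² e^{-(i/ħ) p β η}`, `β = 2λ/α`. -/
def kernelF (hbar alpha lam : ℝ) (χ : ℝ → ℂ) (η : ℝ) : ℂ :=
  ∫ p : ℝ, ((‖χ p‖ ^ 2 : ℝ) : ℂ) *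
    Complex.exp (-(Complex.I / hbar) * p * couplingBeta alpha lam * η)

/-- The kernel `S_{kl}(b, b')` that controls orthogonality; `x = a_k`, `y = a_l`. -/
def kernelS (hbar alpha lam : ℝ) (χ Φ : ℝ → ℂ) (x y b b' : ℝ) : ℂ :=
  ∫ c : ℝ, Complex.exp (Complex.I / hbar * lam * (y - x) * c) * ((‖Φ c‖ ^ 2 : ℝ) : ℂ) *
    kernelF hbar alpha lam χ (b' - c) * kernelF hbar alpha lam χ (c - b)

/-- `T` is the operator `∬ db db' K(b, b') |b⟩⟨b'|`. -/
def HasKernel (T : PointerSpace →L[ℂ] PointerSpace) (K : ℝ → ℝ → ℂ) : Prop :=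
  ∀ f : PointerSpace, ∀ᵐ b : ℝ, T f b = ∫ b' : ℝ, K b b' * f b'

/-- The kernel `I_{kl}(b, b')` that controls the coherences; `x = a_k`, `y = a_l`. -/
def kernelI (hbar alpha lam : ℝ) (Ψ : ℝ → ℂ) (x y b b' : ℝ) : ℂ :=
  ∫ q : ℝ, Complex.exp (-(Complex.I / hbar) * alpha * q * (x - y)) *
    Ψ (q - couplingBeta alpha lam * b) *
      (starRingEnd ℂ) (Ψ (q - couplingBeta alpha lam * b'))

section Measurement

variable {N : ℕ}

/-- `e^{-(i/ħ) β 1 ⊗ P ⊗ B}` on wave functions `Ψ(k, q, b)` (`k` numbers the eigenvectors of `A`,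
`q` is the probe position and `b` the value of `B`): translation of `q` by `β b`. -/
def evolPB (beta : ℝ) (Ψ : Fin N → ℝ → ℝ → ℂ) : Fin N → ℝ → ℝ → ℂ :=
  fun k q b => Ψ k (q - beta * b) b

/-- `e^{-(i/ħ) α A ⊗ Q ⊗ 1}` on wave functions `Ψ(k, q, b)`. -/
def evolAQ (hbar alpha : ℝ) (a : Fin N → ℝ) (Ψ : Fin N → ℝ → ℝ → ℂ) : Fin N → ℝ → ℝ → ℂ :=
  fun k q b => Complex.exp (-(Complex.I / hbar) * alpha * a k * q) * Ψ k q b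

/-- `e^{(i/2ħ) α β A ⊗ 1 ⊗ B}` on wave functions `Ψ(k, q, b)`. -/
def evolAB (hbar alpha beta : ℝ) (a : Fin N → ℝ) (Ψ : Fin N → ℝ → ℝ → ℂ) :
    Fin N → ℝ → ℝ → ℂ :=
  fun k q b => Complex.exp (Complex.I / (2 * hbar) * alpha * beta * a k * b) * Ψ k q b

/-- The state `U_AB U_AQ U_PB (ψ₀ ⊗ Ψ ⊗ Φ)` after the measurement; `c k = ⟨φ_k|ψ₀⟩`. -/
def finalState (hbar alpha lam : ℝ) (a : Fin N → ℝ) (c : Fin N → ℂ) (Ψ Φ : ℝ → ℂ) :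
    Fin N → ℝ → ℝ → ℂ :=
  evolAB hbar alpha (couplingBeta alpha lam) a
    (evolAQ hbar alpha a
      (evolPB (couplingBeta alpha lam) fun k q b => c k * Ψ q * Φ b))

/-- The Hilbert space of system and pointer, `H_S ⊗ L²(ℝ)`, with the system written in the
eigenbasis `φ_k` of `A`: the vector `v` stands for `∑ k, φ_k ⊗ v k`. -/
abbrev SystemPointerSpace (N : ℕ) : Type := PiLp 2 fun _ : Fin N => PointerSpace

/-- The partial trace over the probe of the pure state with wave function `Ψ(k, q, b)`:
`∫ dq |Ψ(·, q, ·)⟩⟨Ψ(·, q, ·)|`. -/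
def traceProbe (Ψ : Fin N → ℝ → ℝ → ℂ) : SystemPointerSpace N →L[ℂ] SystemPointerSpace N :=
  ∫ q : ℝ, InnerProductSpace.rankOne ℂ
    (WithLp.toLp 2 fun k => toL2 (Ψ k q) : SystemPointerSpace N)
    (WithLp.toLp 2 fun k => toL2 (Ψ k q) : SystemPointerSpace N)

/-- The subspaces `S_k`: for `k = 1, …, N` (here `some k`) the support of `ρ_k`, the orthogonal
complement of its kernel; for `k = 0` (here `none`) the common kernel of all `ρ_k`. -/
def supportSpace (ρ : Fin N → PointerSpace →L[ℂ] PointerSpace) :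
    Option (Fin N) → Submodule ℂ PointerSpace
  | none => ⨅ k, LinearMap.ker (ρ k).toLinearMap
  | some k => (LinearMap.ker (ρ k).toLinearMap)ᗮ

end Measurement

/-- Projection valued measure on a finite set of outcomes. -/
structure IsProjectionValuedMeasure {Ω : Type*} [Fintype Ω]
    (E : Ω → PointerSpace →L[ℂ] PointerSpace) : Prop where
  isStarProjection : ∀ i, IsStarProjection (E i)
  orthogonal : ∀ i j, i ≠ j → E i * E j = 0
  sum_eq_one : ∑ i, E i = 1

/-- `λ₀ = 2 ħ b₀ / a₀`. -/
def lambdaZero (hbar b₀ a₀ : ℝ) : ℝ := 2 * hbar * b₀ / a₀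

/-- `α₀ = 4 ħ κ₀ / (a₀ - 2 ħ b₀ / λ)`. -/
def alphaZero (hbar κ₀ b₀ a₀ lam : ℝ) : ℝ := 4 * hbar * κ₀ / (a₀ - 2 * hbar * b₀ / lam)

/-- `α_D = 2 ħ κ₀ / a₀`. -/
def alphaD (hbar κ₀ a₀ : ℝ) : ℝ := 2 * hbar * κ₀ / a₀

end

/-! Everything rests on one fact about frequencies. If `ψ₁`, `ψ₂` have spectra in `[-κ, κ]`, then
`ψ₁ ψ̄₂` carries only frequencies of modulus at most `2κ`, so its integral against `e^{iνx}`
vanishes for `|ν| > 2κ`. This is `IsFourierPair.integral_exp_mul_conj_eq_zero`, a consequence of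
Parseval's identity.

For `S_{kl}`, both factors `F` are written as integrals over momenta `p`, `p'`. The remaining
position integral tests `|Φ|²` at the frequency `(λ(a_l - a_k) + (p - p')β)/ħ`. Since `|p|, |p'| ≤
ħκ₀`, its modulus is at least `λa₀/ħ - 2κ₀β`; with `β = 2λ/α` and `λ > λ₀` this bound exceeds `2b₀`
exactly when `α > α₀`. Hence `S_{kl} = 0` and `ρ_k ρ_l = 0`.

For `I_{kl}`, two translates of `Ψ` are tested at the frequency `α(a_l - a_k)/ħ`, which lies beyond
`2κ₀` once `α > α_D`, so the off-diagonal blocks of the reduced state vanish. On the diagonal,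
Parseval turns `I_{kk}(b, b')` into `F(b - b')`, and the block is a multiple of `ρ_k`.

Operators are compared through their kernels. The pointer states (averages over `p`) and the blocks
(averages over `q`) both have the form `∫ w(s) |m_s Φ⟩⟨n_s Φ| ds`, which
`IsWeightedFamily.hasKernel` treats at once. The decomposition into supports is pure operator
theory: it needs only self-adjointness and `ρ_k ρ_l = 0`. -/

noncomputable section

/-! ### Parseval's identity and band-limited functions -/

open scoped FourierTransform SchwartzMap in
/-- On `L¹ ∩ L²` the Fourier integral agrees with the Fourier transform of `L²`. -/
theorem fourier_toLp_eq_toLp_fourierIntegral {G h : ℝ → ℂ} (hG1 : Integrable G)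
    (hG : MemLp G 2) (hh : MemLp h 2) (hGh : ∀ y, h y = 𝓕 G y) :
    hh.toLp h = 𝓕 (hG.toLp G) := by
  -- The two sides are compared as tempered distributions, where the transform can be moved onto the
  -- Schwartz test function; the embedding of `L²` is injective.
  have key : (Lp.toTemperedDistributionCLM ℂ (volume : Measure ℝ) 2)
      (hh.toLp h - 𝓕 (hG.toLp G)) = 0 := by
    rw [map_sub, sub_eq_zero, Lp.toTemperedDistributionCLM_apply,
      Lp.toTemperedDistributionCLM_apply, ← Lp.fourier_toTemperedDistribution_eq]
    ext s
    rw [TemperedDistribution.fourier_apply, Lp.toTemperedDistribution_apply,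
      Lp.toTemperedDistribution_apply]
    have h1 : ∫ x, s x • (hh.toLp h) x = ∫ x, s x • 𝓕 G x := by
      refine integral_congr_ae ?_
      filter_upwards [hh.coeFn_toLp] with x hx
      rw [hx, hGh]
    have h2 : ∫ x, (𝓕 s) x • (hG.toLp G) x = ∫ x, 𝓕 (s : ℝ → ℂ) x • G x := by
      refine integral_congr_ae ?_
      filter_upwards [hG.coeFn_toLp] with x hx
      rw [hx, SchwartzMap.fourier_coe]
    rw [h1, h2]
    have := VectorFourier.integral_fourierIntegral_smul_eq_flip (L := innerₗ ℝ)
      (μ := volume) (ν := volume) Real.continuous_fourierChar continuous_inner s.integrable hG1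
    simpa using! this.symm
  have hker : hh.toLp h - 𝓕 (hG.toLp G) ∈
      (Lp.toTemperedDistributionCLM ℂ (volume : Measure ℝ) 2).ker := key
  rw [Lp.ker_toTemperedDistributionCLM_eq_bot] at hker
  exact sub_eq_zero.1 (by simpa using hker)

/-- `ψ(x) = ∫ e^{i x k} g(k) dk`, with `g ∈ L¹ ∩ L²` and `ψ ∈ L²`. -/
structure IsFourierPair (ψ g : ℝ → ℂ) : Prop where
  memLp : MemLp ψ 2
  memLp_amplitude : MemLp g 2
  integrable_amplitude : Integrable g
  eq_integral : ∀ x : ℝ, ψ x = ∫ k : ℝ, Complex.exp (Complex.I * x * k) * g k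

theorem norm_exp_of_re_eq_zero {z : ℂ} (hz : z.re = 0) : ‖Complex.exp z‖ = 1 := by
  rw [Complex.norm_exp, hz, Real.exp_zero]

namespace IsFourierPair

-- `𝓕` has the kernel `e^{-2πi k y}`, so the convention `e^{ixk}` corresponds to `x = -2πy`. This
-- rescaling is the source of the factor `2π` in Parseval's identity.
open scoped FourierTransform in
theorem fourier_eq {ψ g : ℝ → ℂ} (h : IsFourierPair ψ g) (y : ℝ) :
    ψ (-(2 * Real.pi) * y) = 𝓕 g y := by
  rw [h.eq_integral, Real.fourier_real_eq_integral_exp_smul]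
  refine integral_congr_ae (.of_forall fun k => ?_)
  simp only [smul_eq_mul]
  congr 2
  push_cast
  ring

theorem memLp_comp_mul {ψ : ℝ → ℂ} (h : MemLp ψ 2) {c : ℝ} (hc : c ≠ 0) :
    MemLp (fun y => ψ (c * y)) 2 := by
  have hq : Measure.QuasiMeasurePreserving (fun y : ℝ => c * y) := by
    refine ⟨by fun_prop, ?_⟩
    rw [Real.map_volume_mul_left hc]
    exact Measure.smul_absolutelyContinuous
  refine (memLp_two_iff_integrable_sq_norm (h.1.comp_quasiMeasurePreserving hq)).2 ?_
  exact ((memLp_two_iff_integrable_sq_norm h.1).1 h).comp_mul_left' hc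

/-- Parseval's identity. -/
theorem integral_mul_conj {ψ₁ g₁ ψ₂ g₂ : ℝ → ℂ} (h₁ : IsFourierPair ψ₁ g₁)
    (h₂ : IsFourierPair ψ₂ g₂) :
    ∫ x, ψ₁ x * (starRingEnd ℂ) (ψ₂ x) =
      2 * Real.pi * ∫ k, g₁ k * (starRingEnd ℂ) (g₂ k) := by
  have hpi : (-(2 * Real.pi)) ≠ 0 := by simp [Real.pi_ne_zero]
  have m₁ := memLp_comp_mul h₁.memLp hpi
  have m₂ := memLp_comp_mul h₂.memLp hpi
  have e₁ := fourier_toLp_eq_toLp_fourierIntegral h₁.integrable_amplitude h₁.memLp_amplitude m₁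
    h₁.fourier_eq
  have e₂ := fourier_toLp_eq_toLp_fourierIntegral h₂.integrable_amplitude h₂.memLp_amplitude m₂
    h₂.fourier_eq
  have key : inner ℂ (m₂.toLp _) (m₁.toLp _) =
      inner ℂ (h₂.memLp_amplitude.toLp g₂) (h₁.memLp_amplitude.toLp g₁) := by
    rw [e₁, e₂, Lp.inner_fourier_eq]
  rw [L2.inner_def, L2.inner_def] at key
  have l1 : ∫ a : ℝ, inner ℂ (m₂.toLp _ a) (m₁.toLp _ a) =
      ∫ a : ℝ, (fun x => ψ₁ x * (starRingEnd ℂ) (ψ₂ x)) (-(2 * Real.pi) * a) := by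
    refine integral_congr_ae ?_
    filter_upwards [m₁.coeFn_toLp, m₂.coeFn_toLp] with x hx1 hx2
    rw [hx1, hx2, RCLike.inner_apply]
  have l2 : ∫ a : ℝ, inner ℂ (h₂.memLp_amplitude.toLp g₂ a) (h₁.memLp_amplitude.toLp g₁ a) =
      ∫ k, g₁ k * (starRingEnd ℂ) (g₂ k) := by
    refine integral_congr_ae ?_
    filter_upwards [h₁.memLp_amplitude.coeFn_toLp, h₂.memLp_amplitude.coeFn_toLp] with x hx1 hx2
    rw [hx1, hx2, RCLike.inner_apply]
  rw [l1, l2, Measure.integral_comp_mul_left (fun x => ψ₁ x * (starRingEnd ℂ) (ψ₂ x))] at key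
  rw [← key, abs_inv, abs_neg, abs_of_pos (by positivity), Complex.real_smul]
  push_cast
  field_simp

/-- Translation of the wave function. -/
theorem comp_sub {ψ g : ℝ → ℂ} (h : IsFourierPair ψ g) (s : ℝ) :
    IsFourierPair (fun x => ψ (x - s)) fun k => Complex.exp (-Complex.I * s * k) * g k := by
  have hm : AEStronglyMeasurable (fun k : ℝ => Complex.exp (-Complex.I * s * k) * g k) :=
    (by fun_prop : Continuous fun k : ℝ => Complex.exp (-Complex.I * s * k)).aestronglyMeasurable.mul
      h.memLp_amplitude.1
  have hn : ∀ k : ℝ, ‖Complex.exp (-Complex.I * s * k) * g k‖ = ‖g k‖ := fun k => by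
    rw [norm_mul, norm_exp_of_re_eq_zero (by simp), one_mul]
  refine ⟨h.memLp.comp_measurePreserving (measurePreserving_sub_right volume s),
    h.memLp_amplitude.congr_norm hm (.of_forall fun k => (hn k).symm),
    h.integrable_amplitude.congr' hm (.of_forall fun k => (hn k).symm), fun x => ?_⟩
  rw [h.eq_integral]
  refine integral_congr_ae (.of_forall fun k => ?_)
  simp only
  rw [← mul_assoc, ← Complex.exp_add]
  congr 2
  push_cast
  ring

/-- Modulation of the wave function. -/
theorem exp_mul {ψ g : ℝ → ℂ} (h : IsFourierPair ψ g) (ν : ℝ) :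
    IsFourierPair (fun x => Complex.exp (Complex.I * ν * x) * ψ x) fun k => g (k - ν) := by
  have hm : AEStronglyMeasurable (fun x : ℝ => Complex.exp (Complex.I * ν * x) * ψ x) :=
    (by fun_prop : Continuous fun x : ℝ => Complex.exp (Complex.I * ν * x)).aestronglyMeasurable.mul
      h.memLp.1
  have hn : ∀ x : ℝ, ‖Complex.exp (Complex.I * ν * x) * ψ x‖ = ‖ψ x‖ := fun k => by
    rw [norm_mul, norm_exp_of_re_eq_zero (by simp), one_mul]
  refine ⟨h.memLp.congr_norm hm (.of_forall fun k => (hn k).symm),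
    h.memLp_amplitude.comp_measurePreserving (measurePreserving_sub_right volume ν),
    h.integrable_amplitude.comp_sub_right ν, fun x => ?_⟩
  rw [h.eq_integral, ← integral_const_mul,
    ← integral_sub_right_eq_self (fun k : ℝ => Complex.exp (Complex.I * ν * x) *
      (Complex.exp (Complex.I * x * k) * g k)) ν]
  refine integral_congr_ae (.of_forall fun k => ?_)
  simp only
  rw [← mul_assoc, ← Complex.exp_add]
  congr 2
  push_cast
  ring

theorem continuous {ψ g : ℝ → ℂ} (h : IsFourierPair ψ g) : Continuous ψ := by
  rw [funext h.eq_integral]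
  refine continuous_of_dominated (bound := fun k => ‖g k‖) (fun x => ?_) (fun x => ?_)
    h.integrable_amplitude.norm (.of_forall fun k => by fun_prop)
  · exact (by fun_prop : Continuous fun k : ℝ =>
      Complex.exp (Complex.I * x * k)).aestronglyMeasurable.mul h.memLp_amplitude.1
  · refine .of_forall fun k => ?_
    rw [norm_mul, norm_exp_of_re_eq_zero (by simp), one_mul]

theorem norm_le {ψ g : ℝ → ℂ} (h : IsFourierPair ψ g) (x : ℝ) : ‖ψ x‖ ≤ ∫ k, ‖g k‖ := by
  rw [h.eq_integral]
  refine norm_integral_le_of_norm_le h.integrable_amplitude.norm (.of_forall fun k => ?_)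
  rw [norm_mul, norm_exp_of_re_eq_zero (by simp), one_mul]

/-- If the amplitudes are supported in `[-κ, κ]`, the product of the wave functions has no
frequencies of modulus larger than `2 κ`. -/
theorem integral_exp_mul_conj_eq_zero {ψ₁ g₁ ψ₂ g₂ : ℝ → ℂ} (h₁ : IsFourierPair ψ₁ g₁)
    (h₂ : IsFourierPair ψ₂ g₂) {κ ν : ℝ} (hg₁ : ∀ k, κ < |k| → g₁ k = 0)
    (hg₂ : ∀ k, κ < |k| → g₂ k = 0) (hν : 2 * κ < |ν|) :
    ∫ x : ℝ, Complex.exp (Complex.I * ν * x) * ψ₁ x * (starRingEnd ℂ) (ψ₂ x) = 0 := by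
  rw [(h₁.exp_mul ν).integral_mul_conj h₂]
  refine mul_eq_zero_of_right _ (integral_eq_zero_of_ae (.of_forall fun k => ?_))
  by_cases hk : κ < |k|
  · simp [hg₂ k hk]
  -- Here `|k| ≤ κ`, so the shift by `|ν| > 2κ` leaves the support of `g₁`: the two supports are
  -- disjoint.
  · have : κ < |k - ν| := by
      have := abs_sub_abs_le_abs_sub ν k
      rw [abs_sub_comm] at this
      linarith
    simp [hg₁ _ this]

end IsFourierPair

theorem HasSpectralAmplitude.isFourierPair {κ : ℝ} (hκ : 0 < κ) {ψ g : ℝ → ℂ}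
    (h : HasSpectralAmplitude κ ψ g) : IsFourierPair ψ g := by
  obtain ⟨hψ, hg, hsupp, heq⟩ := h
  have hzero : ∀ k, k ∉ Set.Icc (-κ) κ → g k = 0 := fun k hk =>
    hsupp k (by rwa [Set.mem_Icc, ← abs_le, not_le] at hk)
  refine ⟨hψ, hg, ?_, fun x => ?_⟩
  · refine IntegrableOn.integrable_of_forall_notMem_eq_zero (s := Set.Icc (-κ) κ) ?_ hzero
    -- On a bounded interval `L² ⊆ L¹`; this is what makes the amplitude integrable.
    have : IsFiniteMeasure ((volume : Measure ℝ).restrict (Set.Icc (-κ) κ)) :=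
      ⟨by simp⟩
    exact (hg.restrict _).integrable (by norm_num)
  · rw [heq, intervalIntegral.integral_of_le (by linarith), ← integral_Icc_eq_integral_Ioc]
    exact setIntegral_eq_integral_of_forall_compl_eq_zero fun k hk => by
      rw [hzero k hk, mul_zero]

/-! ### Integrals of rank-one operators and their kernels -/

theorem toL2_of_memLp {f : ℝ → ℂ} (h : MemLp f 2) : toL2 f = h.toLp f := dif_pos h

theorem coeFn_toL2 {f : ℝ → ℂ} (h : MemLp f 2) : toL2 f =ᵐ[volume] f := by
  rw [toL2_of_memLp h]
  exact h.coeFn_toLp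

theorem norm_toL2_sq {f : ℝ → ℂ} (h : MemLp f 2) : ‖toL2 f‖ ^ 2 = ∫ b, ‖f b‖ ^ 2 := by
  have h1 := inner_self_eq_norm_sq_to_K (𝕜 := ℂ) (toL2 f)
  rw [L2.inner_def] at h1
  have h2 : ∫ b, inner ℂ (toL2 f b) (toL2 f b) = ((∫ b, ‖f b‖ ^ 2 : ℝ) : ℂ) := by
    rw [← integral_complex_ofReal]
    refine integral_congr_ae ?_
    filter_upwards [coeFn_toL2 h] with b hb
    rw [hb, inner_self_eq_norm_sq_to_K]
    simp
  rw [h2] at h1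
  exact Complex.ofReal_injective (by simpa using h1.symm)

theorem aestronglyMeasurable_rankOne {E : Type*} [NormedAddCommGroup E] [InnerProductSpace ℂ E]
    {V U : ℝ → E} (hV : Continuous V) (hU : Continuous U) :
    AEStronglyMeasurable fun s => InnerProductSpace.rankOne ℂ (V s) (U s) := by
  simp only [InnerProductSpace.rankOne_def']
  exact (((ContinuousLinearMap.toSpanSingletonCLE (𝕜 := ℂ)).continuous.comp hV).clm_comp
    ((innerSL ℂ).continuous.comp hU)).aestronglyMeasurable

/-- A weight `w` and a bounded continuous family `m s` of functions for which `|w| |m · b|²` is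
integrable, uniformly in `b`. -/
structure IsWeightedFamily (w : ℝ → ℂ) (m : ℝ → ℝ → ℂ) (M C : ℝ) : Prop where
  aestronglyMeasurable_weight : AEStronglyMeasurable w
  continuous : Continuous fun z : ℝ × ℝ => m z.1 z.2
  norm_le : ∀ s b, ‖m s b‖ ≤ M
  integrable : ∀ b, Integrable fun s => ‖w s‖ * ‖m s b‖ ^ 2
  integral_le : ∀ b, ∫ s, ‖w s‖ * ‖m s b‖ ^ 2 ≤ C

namespace IsWeightedFamily

variable {w : ℝ → ℂ} {m n : ℝ → ℝ → ℂ} {M C M' C' : ℝ} {Φ : ℝ → ℂ}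

theorem continuous_left (h : IsWeightedFamily w m M C) (b : ℝ) : Continuous fun s => m s b :=
  h.continuous.comp (by fun_prop : Continuous fun s : ℝ => (s, b))

theorem continuous_right (h : IsWeightedFamily w m M C) (s : ℝ) : Continuous (m s) :=
  h.continuous.comp (by fun_prop : Continuous fun b : ℝ => (s, b))

theorem memLp (h : IsWeightedFamily w m M C) (hΦ : MemLp Φ 2) (s : ℝ) :
    MemLp (fun b => m s b * Φ b) 2 := by
  refine hΦ.of_le_mul (c := M) ((h.continuous_right s).aestronglyMeasurable.mul hΦ.1)
    (.of_forall fun b => ?_)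
  rw [norm_mul]
  exact mul_le_mul_of_nonneg_right (h.norm_le s b) (norm_nonneg _)

/-- Dominated convergence with the majorant `(2M)² |Φ|²`. The continuity supplies the measurability
of the operator-valued integrands below. -/
theorem continuous_toL2 (h : IsWeightedFamily w m M C) (hΦ : MemLp Φ 2) :
    Continuous fun s => toL2 fun b => m s b * Φ b := by
  have hΦ2 := (memLp_two_iff_integrable_sq_norm hΦ.1).1 hΦ
  refine continuous_iff_continuousAt.2 fun s₀ => ?_
  rw [ContinuousAt, tendsto_iff_norm_sub_tendsto_zero]
  have hsq : ∀ s, ‖(toL2 fun b => m s b * Φ b) - toL2 fun b => m s₀ b * Φ b‖ ^ 2 =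
      ∫ b, ‖m s b - m s₀ b‖ ^ 2 * ‖Φ b‖ ^ 2 := fun s => by
    have hd := (h.memLp hΦ s).sub (h.memLp hΦ s₀)
    have : (toL2 fun b => m s b * Φ b) - (toL2 fun b => m s₀ b * Φ b) =
        toL2 ((fun b => m s b * Φ b) - fun b => m s₀ b * Φ b) := by
      rw [toL2_of_memLp hd, toL2_of_memLp (h.memLp hΦ s), toL2_of_memLp (h.memLp hΦ s₀)]
      rfl
    rw [this, norm_toL2_sq hd]
    refine integral_congr_ae (.of_forall fun b => ?_)
    simp only [Pi.sub_apply]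
    rw [← sub_mul, norm_mul, mul_pow]
  have hcont : Continuous fun s => ∫ b, ‖m s b - m s₀ b‖ ^ 2 * ‖Φ b‖ ^ 2 := by
    refine continuous_of_dominated (bound := fun b => (M + M) ^ 2 * ‖Φ b‖ ^ 2) (fun s => ?_)
      (fun s => .of_forall fun b => ?_) (hΦ2.const_mul _) (.of_forall fun b => ?_)
    · exact (((h.continuous_right s).sub (h.continuous_right s₀)).norm.pow 2).aestronglyMeasurable.mul
        hΦ2.1
    · rw [Real.norm_of_nonneg (by positivity)]
      gcongr
      exact (norm_sub_le _ _).trans (add_le_add (h.norm_le _ _) (h.norm_le _ _))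
    · exact (((h.continuous_left b).sub continuous_const).norm.pow 2).mul continuous_const
  have h0 := (hcont.tendsto s₀)
  simp only [sub_self, norm_zero, ne_eq, OfNat.ofNat_ne_zero, not_false_eq_true, zero_pow,
    zero_mul, integral_zero] at h0
  have h1 := h0.sqrt
  rw [Real.sqrt_zero] at h1
  refine h1.congr fun s => ?_
  rw [← hsq, Real.sqrt_sq (norm_nonneg _)]

/-- Tonelli: integrating over `s` first leaves at most `C |Φ(b)|²`, because the bound `C` is uniform
in `b`. -/
theorem integrable_mul_norm_toL2_sq (h : IsWeightedFamily w m M C) (hΦ : MemLp Φ 2) :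
    Integrable fun s => ‖w s‖ * ‖toL2 fun b => m s b * Φ b‖ ^ 2 := by
  have hΦ2 := (memLp_two_iff_integrable_sq_norm hΦ.1).1 hΦ
  have hmeas : AEStronglyMeasurable (fun z : ℝ × ℝ => ‖w z.1‖ * ‖m z.1 z.2‖ ^ 2 * ‖Φ z.2‖ ^ 2)
      (volume.prod volume) :=
    ((h.aestronglyMeasurable_weight.norm.comp_fst).mul
      (h.continuous.norm.pow 2).aestronglyMeasurable).mul hΦ2.1.comp_snd
  have hint : Integrable (fun z : ℝ × ℝ => ‖w z.1‖ * ‖m z.1 z.2‖ ^ 2 * ‖Φ z.2‖ ^ 2)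
      (volume.prod volume) := by
    refine (integrable_prod_iff' hmeas).2 ⟨.of_forall fun b => (h.integrable b).mul_const (‖Φ b‖ ^ 2), ?_⟩
    refine (hΦ2.const_mul C).mono' hmeas.prod_swap.norm.integral_prod_right'
      (.of_forall fun b => ?_)
    have : ∀ s, ‖‖w s‖ * ‖m s b‖ ^ 2 * ‖Φ b‖ ^ 2‖ = ‖w s‖ * ‖m s b‖ ^ 2 * ‖Φ b‖ ^ 2 :=
      fun s => Real.norm_of_nonneg (by positivity)
    simp only [this]
    rw [integral_mul_const, Real.norm_of_nonneg
      (mul_nonneg (integral_nonneg fun s => by positivity) (by positivity))]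
    exact mul_le_mul_of_nonneg_right (h.integral_le b) (by positivity)
  refine hint.integral_prod_left.congr (.of_forall fun s => ?_)
  simp only
  rw [norm_toL2_sq (h.memLp hΦ s), ← integral_const_mul]
  refine integral_congr_ae (.of_forall fun b => ?_)
  simp only
  rw [norm_mul, mul_pow, mul_assoc]

theorem integrable_rankOne (h : IsWeightedFamily w m M C) (h' : IsWeightedFamily w n M' C')
    (hΦ : MemLp Φ 2) :
    Integrable fun s => w s • InnerProductSpace.rankOne ℂ
      (toL2 fun b => m s b * Φ b) (toL2 fun b => n s b * Φ b) := by
  refine ((h.integrable_mul_norm_toL2_sq hΦ).add (h'.integrable_mul_norm_toL2_sq hΦ)).mono' ?_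
    (.of_forall fun s => ?_)
  · exact h.aestronglyMeasurable_weight.smul
      (aestronglyMeasurable_rankOne (h.continuous_toL2 hΦ) (h'.continuous_toL2 hΦ))
  · rw [norm_smul, InnerProductSpace.norm_rankOne, Pi.add_apply, ← mul_add]
    refine mul_le_mul_of_nonneg_left ?_ (norm_nonneg _)
    nlinarith [two_mul_le_add_sq ‖toL2 fun b => m s b * Φ b‖ ‖toL2 fun b => n s b * Φ b‖,
      sq_nonneg ‖toL2 fun b => m s b * Φ b‖, sq_nonneg ‖toL2 fun b => n s b * Φ b‖]

theorem integrable_mul_conj (h : IsWeightedFamily w m M C) (h' : IsWeightedFamily w n M' C')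
    (b b' : ℝ) : Integrable fun s => w s * m s b * (starRingEnd ℂ) (n s b') := by
  refine ((h.integrable b).add (h'.integrable b')).mono'
    ((h.aestronglyMeasurable_weight.mul (h.continuous_left b).aestronglyMeasurable).mul
      (Complex.continuous_conj.comp (h'.continuous_left b')).aestronglyMeasurable)
    (.of_forall fun s => ?_)
  rw [norm_mul, norm_mul, RCLike.norm_conj, Pi.add_apply, ← mul_add, mul_assoc]
  refine mul_le_mul_of_nonneg_left ?_ (norm_nonneg _)
  nlinarith [two_mul_le_add_sq ‖m s b‖ ‖n s b'‖, sq_nonneg ‖m s b‖, sq_nonneg ‖n s b'‖]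

theorem integral_norm_mul_conj_le (h : IsWeightedFamily w m M C) (h' : IsWeightedFamily w n M' C')
    (b b' : ℝ) : ∫ s, ‖w s * m s b * (starRingEnd ℂ) (n s b')‖ ≤ C + C' := by
  refine le_trans ?_ (add_le_add (h.integral_le b) (h'.integral_le b'))
  rw [← integral_add (h.integrable b) (h'.integrable b')]
  refine integral_mono (h.integrable_mul_conj h' b b').norm
    ((h.integrable b).add (h'.integrable b')) fun s => ?_
  simp only
  rw [norm_mul, norm_mul, RCLike.norm_conj, ← mul_add, mul_assoc]
  refine mul_le_mul_of_nonneg_left ?_ (norm_nonneg _)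
  nlinarith [two_mul_le_add_sq ‖m s b‖ ‖n s b'‖, sq_nonneg ‖m s b‖, sq_nonneg ‖n s b'‖]

theorem integrable_prod (h : IsWeightedFamily w m M C) (h' : IsWeightedFamily w n M' C')
    {u v : ℝ → ℂ} (hu : Integrable u) (hv : Integrable v) :
    Integrable (fun z : (ℝ × ℝ) × ℝ => u z.1.1 * v z.1.2 *
      (w z.2 * m z.2 z.1.1 * (starRingEnd ℂ) (n z.2 z.1.2)))
      ((volume.prod volume).prod volume) := by
  have huv : Integrable (fun z : ℝ × ℝ => u z.1 * v z.2) (volume.prod volume) := hu.mul_prod hv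
  have hmeas : AEStronglyMeasurable (fun z : (ℝ × ℝ) × ℝ => u z.1.1 * v z.1.2 *
      (w z.2 * m z.2 z.1.1 * (starRingEnd ℂ) (n z.2 z.1.2)))
      ((volume.prod volume).prod volume) := by
    refine huv.1.comp_fst.mul ((h.aestronglyMeasurable_weight.comp_snd.mul
      (Continuous.aestronglyMeasurable ?_)).mul (Continuous.aestronglyMeasurable ?_))
    · exact h.continuous.comp (by fun_prop : Continuous fun z : (ℝ × ℝ) × ℝ => (z.2, z.1.1))
    · exact Complex.continuous_conj.comp (h'.continuous.comp
        (by fun_prop : Continuous fun z : (ℝ × ℝ) × ℝ => (z.2, z.1.2)))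
  refine (integrable_prod_iff hmeas).2
    ⟨.of_forall fun z => (h.integrable_mul_conj h' z.1 z.2).const_mul (u z.1 * v z.2), ?_⟩
  refine (huv.norm.mul_const (C + C')).mono' hmeas.norm.integral_prod_right'
    (.of_forall fun z => ?_)
  rw [Real.norm_of_nonneg (integral_nonneg fun s => norm_nonneg _)]
  simp only [norm_mul (u z.1 * v z.2)]
  rw [integral_const_mul]
  exact mul_le_mul_of_nonneg_left (h.integral_norm_mul_conj_le h' z.1 z.2) (norm_nonneg _)

/-- The operator `∫ ds w(s) |m_s Φ⟩⟨n_s Φ|` has the kernel `Φ(b) Φ̄(b') ∫ ds w m(s,b) n̄(s,b')`. -/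
theorem hasKernel (h : IsWeightedFamily w m M C) (h' : IsWeightedFamily w n M' C')
    (hΦ : MemLp Φ 2) :
    HasKernel (∫ s, w s • InnerProductSpace.rankOne ℂ
      (toL2 fun b => m s b * Φ b) (toL2 fun b => n s b * Φ b)) fun b b' =>
      Φ b * (starRingEnd ℂ) (Φ b') * ∫ s, w s * m s b * (starRingEnd ℂ) (n s b') := by
  intro f
  have hT := h.integrable_rankOne h' hΦ
  have hΦf : Integrable fun b' => (starRingEnd ℂ) (Φ b') * f b' := hΦ.star.integrable_mul (Lp.memLp f)
  have happ := ContinuousLinearMap.integral_apply hT f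
  have hTf : Integrable fun s => (w s • InnerProductSpace.rankOne ℂ
      (toL2 fun b => m s b * Φ b) (toL2 fun b => n s b * Φ b)) f :=
    (ContinuousLinearMap.apply ℂ PointerSpace f).integrable_comp hT
  -- `Φ` is only known to be in `L²`; cutting it off to a set of finite measure makes it integrable,
  -- so that Fubini applies.
  have hind : ∀ A : Set ℝ, MeasurableSet A → volume A < ⊤ → Integrable (A.indicator Φ) :=
    fun A hA hA' => by
      have : IsFiniteMeasure ((volume : Measure ℝ).restrict A) := ⟨by simpa using hA'⟩
      have hI : IntegrableOn Φ A := (hΦ.restrict A).integrable (by norm_num)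
      exact hI.integrable_indicator hA
  have hinner : ∀ (A : Set ℝ) (b : ℝ), ∫ b', A.indicator Φ b * ((starRingEnd ℂ) (Φ b') * f b') *
      ∫ s, w s * m s b * (starRingEnd ℂ) (n s b') =
      A.indicator (fun b => ∫ b', Φ b * (starRingEnd ℂ) (Φ b') *
        (∫ s, w s * m s b * (starRingEnd ℂ) (n s b')) * f b') b := by
    intro A b
    by_cases hb : b ∈ A
    · simp only [Set.indicator_of_mem hb]
      refine integral_congr_ae (.of_forall fun b' => ?_)
      simp only
      ring
    · simp [Set.indicator_of_notMem hb]
  have hprod : ∀ A : Set ℝ, MeasurableSet A → volume A < ⊤ →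
      Integrable (fun z : ℝ × ℝ => A.indicator Φ z.1 * ((starRingEnd ℂ) (Φ z.2) * f z.2) *
        ∫ s, w s * m s z.1 * (starRingEnd ℂ) (n s z.2)) (volume.prod volume) := by
    intro A hA hA'
    refine (h.integrable_prod h' (hind A hA hA') hΦf).integral_prod_left.congr
      (.of_forall fun z => ?_)
    simp only
    rw [integral_const_mul]
  refine ae_eq_of_forall_setIntegral_eq_of_sigmaFinite (fun A hA hA' => ?_) (fun A hA hA' => ?_)
    fun A hA hA' => ?_
  · have : IsFiniteMeasure ((volume : Measure ℝ).restrict A) := ⟨by simpa using hA'⟩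
    exact ((Lp.memLp _).restrict A).integrable (by norm_num)
  · rw [← integrable_indicator_iff hA]
    refine (hprod A hA hA').integral_prod_left.congr (.of_forall fun b => ?_)
    exact hinner A b
  -- The integral over `A` is an inner product with an indicator, a bounded functional that passes
  -- through the operator integral.
  · rw [← L2.inner_indicatorConstLp_one hA hA'.ne, happ, ← integral_inner hTf,
      ← integral_indicator hA]
    have hR : ∫ b, A.indicator (fun b => ∫ b', Φ b * (starRingEnd ℂ) (Φ b') *
        (∫ s, w s * m s b * (starRingEnd ℂ) (n s b')) * f b') b =
        ∫ s, ∫ z : ℝ × ℝ, A.indicator Φ z.1 * ((starRingEnd ℂ) (Φ z.2) * f z.2) *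
          (w s * m s z.1 * (starRingEnd ℂ) (n s z.2)) ∂(volume.prod volume) := by
      rw [← integral_integral_swap (h.integrable_prod h' (hind A hA hA') hΦf)]
      simp only [integral_const_mul]
      rw [integral_prod _ (hprod A hA hA')]
      exact integral_congr_ae (.of_forall fun b => (hinner A b).symm)
    rw [hR]
    refine integral_congr_ae (.of_forall fun s => ?_)
    simp only
    have e1 : ∫ z : ℝ × ℝ, A.indicator Φ z.1 * ((starRingEnd ℂ) (Φ z.2) * f z.2) *
          (w s * m s z.1 * (starRingEnd ℂ) (n s z.2)) ∂(volume.prod volume) =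
        w s * ((∫ b, A.indicator (fun b => m s b * Φ b) b) *
          ∫ b', (starRingEnd ℂ) (n s b' * Φ b') * f b') := by
      rw [← integral_prod_mul, ← integral_const_mul]
      refine integral_congr_ae (.of_forall fun z => ?_)
      simp only [map_mul]
      by_cases hz : z.1 ∈ A
      · simp only [Set.indicator_of_mem hz]
        ring
      · simp [Set.indicator_of_notMem hz]
    rw [e1, _root_.smul_apply, InnerProductSpace.rankOne_apply, inner_smul_right,
      inner_smul_right, L2.inner_indicatorConstLp_one hA hA'.ne, integral_indicator hA,
      L2.inner_def]
    rw [mul_comm (∫ x in A, _)]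
    congr 2
    · refine integral_congr_ae ?_
      filter_upwards [coeFn_toL2 (h'.memLp hΦ s)] with b hb
      rw [hb, RCLike.inner_apply, mul_comm]
    · refine integral_congr_ae (ae_restrict_of_ae ?_)
      exact coeFn_toL2 (h.memLp hΦ s)

end IsWeightedFamily

/-! ### Supports of mutually annihilating self-adjoint operators -/

section Supports

variable {N : ℕ} {ρ : Fin N → PointerSpace →L[ℂ] PointerSpace}

instance hasOrthogonalProjection_supportSpace (i : Option (Fin N)) :
    (supportSpace ρ i).HasOrthogonalProjection := by
  have : CompleteSpace (supportSpace ρ i) := by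
    refine IsClosed.completeSpace_coe (hs := ?_)
    cases i with
    | none =>
      simp only [supportSpace, Submodule.coe_iInf]
      exact isClosed_iInter fun k => (ρ k).isClosed_ker
    | some k => exact Submodule.isClosed_orthogonal _
  infer_instance

theorem orthogonal_supportSpace_some (k : Fin N) :
    (supportSpace ρ (some k))ᗮ = LinearMap.ker (ρ k).toLinearMap := by
  have : CompleteSpace (LinearMap.ker (ρ k).toLinearMap) :=
    (ρ k).isClosed_ker.completeSpace_coe
  exact Submodule.orthogonal_orthogonal _

/-- `ρ_k ρ_l = 0` puts the range of `ρ_l` into `ker ρ_k`. Taking orthogonal complements gives the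
inclusion, since the complement of the range of the self-adjoint `ρ_l` is `ker ρ_l`. -/
theorem supportSpace_some_le_ker (hsa : ∀ k, IsSelfAdjoint (ρ k))
    (horth : ∀ k l, k ≠ l → ρ k * ρ l = 0) {k l : Fin N} (hkl : k ≠ l) :
    supportSpace ρ (some k) ≤ LinearMap.ker (ρ l).toLinearMap := by
  intro v hv
  have h1 : ∀ w, ρ l w ∈ LinearMap.ker (ρ k).toLinearMap := fun w =>
    LinearMap.mem_ker.2 (congrArg (fun T : PointerSpace →L[ℂ] PointerSpace => T w)
      (horth k l hkl))
  rw [LinearMap.mem_ker]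
  refine ext_inner_left ℂ fun w => ?_
  rw [inner_zero_right]
  have h2 : inner ℂ (ρ l w) v = 0 := hv _ (h1 w)
  rw [← h2]
  exact ((ContinuousLinearMap.isSelfAdjoint_iff_isSymmetric.1 (hsa l)) w v).symm

theorem supportSpace_isOrtho (hsa : ∀ k, IsSelfAdjoint (ρ k))
    (horth : ∀ k l, k ≠ l → ρ k * ρ l = 0) (i j : Option (Fin N)) (hij : i ≠ j) :
    supportSpace ρ i ⟂ supportSpace ρ j := by
  have h0 : ∀ k, supportSpace ρ none ⟂ supportSpace ρ (some k) := fun k => by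
    rw [Submodule.isOrtho_iff_le, orthogonal_supportSpace_some]
    exact iInf_le _ k
  cases i with
  | none =>
    cases j with
    | none => exact absurd rfl hij
    | some l => exact h0 l
  | some k =>
    cases j with
    | none => exact (h0 k).symm
    | some l =>
      rw [Submodule.isOrtho_iff_le, orthogonal_supportSpace_some]
      exact supportSpace_some_le_ker hsa horth fun h => hij (congrArg some h)

theorem sum_starProjection_supportSpace (hsa : ∀ k, IsSelfAdjoint (ρ k))
    (horth : ∀ k l, k ≠ l → ρ k * ρ l = 0) :
    ∑ i, (supportSpace ρ i).starProjection = 1 := by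
  ext1 v
  rw [Fintype.sum_option, _root_.add_apply, one_apply_eq_self]
  set u : PointerSpace := ∑ k, (supportSpace ρ (some k)).starProjection v with hu
  have hsum : (∑ k, (supportSpace ρ (some k)).starProjection) v = u := by
    rw [_root_.sum_apply]
  -- `ρ_k` kills `v - P_k v` by definition of the support, and kills every `P_l v` with `l ≠ k` by
  -- orthogonality; so the remainder lies in the common kernel.
  have hmem : v - u ∈ supportSpace ρ none := by
    simp only [supportSpace, Submodule.mem_iInf]
    intro k
    rw [LinearMap.mem_ker, hu, ← Finset.add_sum_erase _ _ (Finset.mem_univ k), ← sub_sub, map_sub,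
      map_sum]
    have h1 : v - (supportSpace ρ (some k)).starProjection v ∈ (supportSpace ρ (some k))ᗮ :=
      Submodule.sub_starProjection_mem_orthogonal v
    rw [orthogonal_supportSpace_some] at h1
    rw [LinearMap.mem_ker.1 h1, zero_sub, neg_eq_zero]
    refine Finset.sum_eq_zero fun l hl => ?_
    exact LinearMap.mem_ker.1 (supportSpace_some_le_ker hsa horth (Finset.ne_of_mem_erase hl)
      (Submodule.starProjection_apply_mem _ _))
  have hu0 : (supportSpace ρ none).starProjection u = 0 := by
    rw [hu, map_sum]
    refine Finset.sum_eq_zero fun k _ => ?_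
    rw [Submodule.starProjection_apply_eq_zero_iff]
    exact (supportSpace_isOrtho hsa horth (some k) none (by simp)).le
      (Submodule.starProjection_apply_mem _ _)
  have hv : (supportSpace ρ none).starProjection v = v - u := by
    conv_lhs => rw [← sub_add_cancel v u]
    rw [map_add, hu0, add_zero, Submodule.starProjection_eq_self_iff.2 hmem]
  rw [hsum, hv, sub_add_cancel]

theorem isInternal_supportSpace (hsa : ∀ k, IsSelfAdjoint (ρ k))
    (horth : ∀ k l, k ≠ l → ρ k * ρ l = 0) : DirectSum.IsInternal (supportSpace ρ) := by
  have hV : OrthogonalFamily ℂ (fun i => supportSpace ρ i)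
      fun i => (supportSpace ρ i).subtypeₗᵢ := fun i j hij v w =>
    (supportSpace_isOrtho hsa horth i j hij).inner_eq v.2 w.2
  refine DirectSum.isInternal_submodule_iff_iSupIndep_and_iSup_eq_top _ |>.2 ⟨hV.independent, ?_⟩
  rw [eq_top_iff]
  intro v _
  have := congrArg (fun T : PointerSpace →L[ℂ] PointerSpace => T v)
    (sum_starProjection_supportSpace hsa horth)
  simp only [_root_.sum_apply, one_apply_eq_self] at this
  rw [← this]
  exact Submodule.sum_mem _ fun i _ =>
    Submodule.mem_iSup_of_mem i (Submodule.starProjection_apply_mem _ _)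

theorem exists_projectionValuedMeasure (hsa : ∀ k, IsSelfAdjoint (ρ k))
    (horth : ∀ k l, k ≠ l → ρ k * ρ l = 0) :
    ∃ E : Option (Fin N) → PointerSpace →L[ℂ] PointerSpace,
      IsProjectionValuedMeasure E ∧
      (∀ i, LinearMap.range (E i).toLinearMap = supportSpace ρ i) ∧
      (∀ k, E (some k) * ρ k = ρ k) ∧ (∀ i k, i ≠ some k → E i * ρ k = 0) := by
  have hrange : ∀ k v, ρ k v ∈ supportSpace ρ (some k) := fun k v u hu => by
    have : inner ℂ (ρ k u) v = inner ℂ u (ρ k v) :=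
      (ContinuousLinearMap.isSelfAdjoint_iff_isSymmetric.1 (hsa k)) u v
    rw [← this, show ρ k u = 0 from hu, inner_zero_left]
  refine ⟨fun i => (supportSpace ρ i).starProjection, ⟨fun i => isStarProjection_starProjection,
    fun i j hij => ?_, sum_starProjection_supportSpace hsa horth⟩,
    fun i => Submodule.range_starProjection _, fun k => ?_, fun i k hik => ?_⟩
  · exact (supportSpace_isOrtho hsa horth i j hij).starProjection_comp_starProjection
  · ext1 v
    exact Submodule.starProjection_eq_self_iff.2 (hrange k v)
  · ext1 v
    refine (Submodule.starProjection_apply_eq_zero_iff _).2 ?_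
    exact (supportSpace_isOrtho hsa horth (some k) i (Ne.symm hik)).le (hrange k v)

end Supports

/-! ### Calculus of integral kernels -/

namespace HasKernel

variable {T T' : PointerSpace →L[ℂ] PointerSpace} {K K' : ℝ → ℝ → ℂ}

theorem unique (h : HasKernel T K) (h' : HasKernel T' K) : T = T' := by
  ext1 f
  refine Lp.ext ?_
  filter_upwards [h f, h' f] with b hb hb'
  rw [hb, hb']

theorem zero : HasKernel 0 fun _ _ => 0 := by
  intro f
  filter_upwards [Lp.coeFn_zero ℂ 2 (volume : Measure ℝ)] with b hb
  simp

theorem const_smul (h : HasKernel T K) (z : ℂ) : HasKernel (z • T) fun b b' => z * K b b' := by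
  intro f
  filter_upwards [h f, Lp.coeFn_smul z (T f)] with b hb hz
  rw [_root_.smul_apply, hz, Pi.smul_apply, hb, smul_eq_mul, ← integral_const_mul]
  simp only [mul_assoc]

theorem mul (h : HasKernel T K) (h' : HasKernel T' K')
    (hint : ∀ (f : PointerSpace) (b : ℝ), Integrable
      (fun z : ℝ × ℝ => K b z.1 * (K' z.1 z.2 * f z.2)) (volume.prod volume)) :
    HasKernel (T * T') fun b b' => ∫ c, K b c * K' c b' := by
  intro f
  filter_upwards [h (T' f)] with b hb
  change T (T' f) b = _
  rw [hb]
  calc ∫ c, K b c * (T' f) c = ∫ c, ∫ b', K b c * (K' c b' * f b') := by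
        refine integral_congr_ae ?_
        filter_upwards [h' f] with c hc
        rw [hc, integral_const_mul]
    _ = ∫ b', ∫ c, K b c * (K' c b' * f b') := integral_integral_swap (hint f b)
    _ = ∫ b', (∫ c, K b c * K' c b') * f b' := by
        refine integral_congr_ae (.of_forall fun b' => ?_)
        simp only
        rw [← integral_mul_const]
        simp only [mul_assoc]

end HasKernel

/-! ### Pointer states and the vanishing of `S_{kl}` -/

section PointerStates

variable {hbar alpha lam : ℝ} {χ Φ : ℝ → ℂ}

theorem integrable_weight (hχ : Integrable fun p => ‖χ p‖ ^ 2) :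
    Integrable fun p => ((‖χ p‖ ^ 2 : ℝ) : ℂ) := hχ.ofReal

theorem norm_exp_phase (p η : ℝ) :
    ‖Complex.exp (-(Complex.I / hbar) * p * couplingBeta alpha lam * η)‖ = 1 := by
  refine norm_exp_of_re_eq_zero ?_
  rw [show -(Complex.I / hbar) * p * couplingBeta alpha lam * η =
    ((-(p * couplingBeta alpha lam * η) / hbar : ℝ) : ℂ) * Complex.I by push_cast; ring]
  simp

theorem continuous_kernelF (hχ : Integrable fun p => ‖χ p‖ ^ 2) :
    Continuous (kernelF hbar alpha lam χ) := by
  unfold kernelF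
  refine continuous_of_dominated (bound := fun p => ‖χ p‖ ^ 2) (fun η => ?_) (fun η => ?_) hχ
    (.of_forall fun p => by fun_prop)
  · exact (integrable_weight hχ).1.mul (by fun_prop : Continuous fun p : ℝ =>
      Complex.exp (-(Complex.I / hbar) * p * couplingBeta alpha lam * η)).aestronglyMeasurable
  · refine .of_forall fun p => ?_
    rw [norm_mul, norm_exp_phase, mul_one, Complex.norm_real, Real.norm_of_nonneg (by positivity)]

theorem norm_kernelF_le (hχ : Integrable fun p => ‖χ p‖ ^ 2) (η : ℝ) :
    ‖kernelF hbar alpha lam χ η‖ ≤ ∫ p, ‖χ p‖ ^ 2 := by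
  refine norm_integral_le_of_norm_le hχ (.of_forall fun p => ?_)
  rw [norm_mul, norm_exp_phase, mul_one, Complex.norm_real, Real.norm_of_nonneg (by positivity)]

theorem kernelF_neg (heven : ∀ᵐ p : ℝ, ‖χ (-p)‖ = ‖χ p‖) (η : ℝ) :
    kernelF hbar alpha lam χ (-η) = kernelF hbar alpha lam χ η := by
  unfold kernelF
  rw [← integral_neg_eq_self]
  refine integral_congr_ae ?_
  filter_upwards [heven] with p hp
  rw [hp]
  congr 2
  push_cast
  ring

theorem isWeightedFamily_expB (hχ : Integrable fun p => ‖χ p‖ ^ 2) (x : ℝ) :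
    IsWeightedFamily (fun p => ((‖χ p‖ ^ 2 : ℝ) : ℂ))
      (fun p b => Complex.exp (Complex.I *
        ((lam * x - p * couplingBeta alpha lam) / hbar : ℝ) * b)) 1 (∫ p, ‖χ p‖ ^ 2) := by
  have hn : ∀ p b : ℝ, ‖Complex.exp (Complex.I *
        ((lam * x - p * couplingBeta alpha lam) / hbar : ℝ) * b)‖ = 1 := fun p b => by
    refine norm_exp_of_re_eq_zero ?_
    rw [mul_assoc, ← Complex.ofReal_mul, mul_comm, Complex.re_ofReal_mul, Complex.I_re, mul_zero]
  have he : ∀ b : ℝ, (fun p => ‖((‖χ p‖ ^ 2 : ℝ) : ℂ)‖ * ‖Complex.exp (Complex.I *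
        ((lam * x - p * couplingBeta alpha lam) / hbar : ℝ) * b)‖ ^ 2) =
      fun p => ‖χ p‖ ^ 2 := fun b => by
    funext p
    rw [hn, one_pow, mul_one, Complex.norm_real, Real.norm_of_nonneg (by positivity)]
  refine ⟨(integrable_weight hχ).1, by fun_prop, fun s b => (hn s b).le, fun b => ?_, fun b => ?_⟩
  · rw [he]
    exact hχ
  · rw [he]

/-- The adjoint is a real-linear homeomorphism, so it commutes with the integral, including the
default value `0` in the non-integrable case. -/
theorem isSelfAdjoint_integral {T : ℝ → PointerSpace →L[ℂ] PointerSpace}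
    (hT : ∀ p, IsSelfAdjoint (T p)) : IsSelfAdjoint (∫ p, T p) := by
  have : StarModule ℝ (PointerSpace →L[ℂ] PointerSpace) := ⟨fun r S => by
    have e : ∀ S : PointerSpace →L[ℂ] PointerSpace, r • S = (r : ℂ) • S := fun S => by
      ext1 f
      exact (Complex.coe_smul r (S f)).symm
    rw [e, star_smul, Complex.star_def, Complex.conj_ofReal, ← e]
    rfl⟩
  have h := (starL' ℝ : (PointerSpace →L[ℂ] PointerSpace) ≃L[ℝ] _).integral_comp_comm T
    (μ := volume)
  have e : ∀ p, (starL' ℝ : (PointerSpace →L[ℂ] PointerSpace) ≃L[ℝ] _) (T p) = T p :=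
    fun p => hT p
  simp only [e] at h
  exact h.symm

theorem isSelfAdjoint_pointerState (x : ℝ) :
    IsSelfAdjoint (pointerState hbar alpha lam χ Φ x) := by
  refine isSelfAdjoint_integral fun p => ?_
  refine IsSelfAdjoint.smul (Complex.conj_ofReal _) ?_
  exact ContinuousLinearMap.isSelfAdjoint_iff_isSymmetric.2
    (InnerProductSpace.isSymmetric_rankOne_self _)

theorem hasKernel_pointerState (hχ : Integrable fun p => ‖χ p‖ ^ 2) (hΦ : MemLp Φ 2) (x : ℝ) :
    HasKernel (pointerState hbar alpha lam χ Φ x) fun b b' =>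
      Φ b * (starRingEnd ℂ) (Φ b') * (Complex.exp (Complex.I / hbar * lam * x * (b - b')) *
        kernelF hbar alpha lam χ (b - b')) := by
  have hw := isWeightedFamily_expB (hbar := hbar) (alpha := alpha) (lam := lam) hχ x
  convert! hw.hasKernel hw hΦ using 4 with b b'
  unfold kernelF
  rw [← integral_const_mul]
  refine integral_congr_ae (.of_forall fun p => ?_)
  simp only [← Complex.exp_conj]
  rw [mul_left_comm, mul_assoc (Complex.ofReal _), ← Complex.exp_add, ← Complex.exp_add]
  congr 2
  simp only [map_mul, Complex.conj_I, Complex.conj_ofReal]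
  push_cast
  ring

theorem hasKernel_pointerState_mul (hχ : Integrable fun p => ‖χ p‖ ^ 2) (hΦ : MemLp Φ 2)
    (heven : ∀ᵐ p : ℝ, ‖χ (-p)‖ = ‖χ p‖) (x y : ℝ) :
    HasKernel (pointerState hbar alpha lam χ Φ x * pointerState hbar alpha lam χ Φ y) fun b b' =>
      Complex.exp (Complex.I / hbar * lam * (x * b - y * b')) * Φ b *
        (starRingEnd ℂ) (Φ b') * kernelS hbar alpha lam χ Φ x y b b' := by
  have hF := continuous_kernelF (hbar := hbar) (alpha := alpha) (lam := lam) hχ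
  have hΦ2 := (memLp_two_iff_integrable_sq_norm hΦ.1).1 hΦ
  have h := (hasKernel_pointerState (hbar := hbar) (alpha := alpha) (lam := lam) hχ hΦ x).mul
    (hasKernel_pointerState (hbar := hbar) (alpha := alpha) (lam := lam) hχ hΦ y) ?_
  · convert! h using 3 with b b'
    unfold kernelS
    rw [← integral_const_mul]
    refine integral_congr_ae (.of_forall fun c => ?_)
    simp only
    -- Composition produces `F(b - c) F(c - b')`, whereas `S_{kl}` is written with the reversed
    -- arguments; evenness of `F`, the fruit of the parity of `⟨p|Ψ⟩`, reconciles them.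
    rw [← kernelF_neg heven (b' - c), ← kernelF_neg heven (c - b), neg_sub, neg_sub]
    have e1 : ((‖Φ c‖ ^ 2 : ℝ) : ℂ) = Φ c * (starRingEnd ℂ) (Φ c) := by
      rw [Complex.mul_conj, Complex.normSq_eq_norm_sq]
    have e2 : Complex.exp (Complex.I / hbar * lam * (x * b - y * b')) *
        Complex.exp (Complex.I / hbar * lam * (y - x) * c) =
        Complex.exp (Complex.I / hbar * lam * x * (b - c)) *
        Complex.exp (Complex.I / hbar * lam * y * (c - b')) := by
      rw [← Complex.exp_add, ← Complex.exp_add]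
      congr 1
      ring
    rw [e1]
    linear_combination (Φ b * (starRingEnd ℂ) (Φ b') * (Φ c * (starRingEnd ℂ) (Φ c)) *
      kernelF hbar alpha lam χ (c - b') * kernelF hbar alpha lam χ (b - c)) * e2
  · intro f b
    have hΦf : Integrable fun b' => (starRingEnd ℂ) (Φ b') * f b' :=
      hΦ.star.integrable_mul (Lp.memLp f)
    have hΦΦ : Integrable fun c => ((‖Φ c‖ ^ 2 : ℝ) : ℂ) := hΦ2.ofReal
    have hcont : Continuous fun z : ℝ × ℝ =>
        Φ b * (Complex.exp (Complex.I / hbar * lam * x * (b - z.1)) *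
          kernelF hbar alpha lam χ (b - z.1)) *
        (Complex.exp (Complex.I / hbar * lam * y * (z.1 - z.2)) *
          kernelF hbar alpha lam χ (z.1 - z.2)) := by
      have h1 := hF.comp (by fun_prop : Continuous fun z : ℝ × ℝ => b - z.1)
      have h2 := hF.comp (by fun_prop : Continuous fun z : ℝ × ℝ => z.1 - z.2)
      simp only [Function.comp_def] at h1 h2
      fun_prop
    have hexp : ∀ x s t : ℝ, ‖Complex.exp (Complex.I / hbar * lam * x * (s - t))‖ = 1 :=
      fun x s t => by
        refine norm_exp_of_re_eq_zero ?_
        rw [show Complex.I / hbar * lam * x * (s - t) =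
          ((lam * x * (s - t) / hbar : ℝ) : ℂ) * Complex.I by push_cast; ring]
        simp
    -- Fubini's hypothesis: a bounded continuous factor times `|Φ(c)|² · Φ̄(b') f(b')`, a product of
    -- two integrable functions.
    refine ((hΦΦ.mul_prod hΦf).bdd_mul (c := ‖Φ b‖ * (∫ p, ‖χ p‖ ^ 2) * ∫ p, ‖χ p‖ ^ 2)
      hcont.aestronglyMeasurable (.of_forall fun z => ?_)).congr (.of_forall fun z => ?_)
    · rw [norm_mul, norm_mul, norm_mul, norm_mul, hexp, hexp, one_mul, one_mul]
      gcongr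
      · exact norm_kernelF_le hχ _
      · exact norm_kernelF_le hχ _
    · simp only
      have e1 : ((‖Φ z.1‖ ^ 2 : ℝ) : ℂ) = Φ z.1 * (starRingEnd ℂ) (Φ z.1) := by
        rw [Complex.mul_conj, Complex.normSq_eq_norm_sq]
      rw [e1]
      ring

/-- After Fubini the integral over `c` is innermost. Within the support of the momentum weights its
frequency exceeds `2b₀`, so it vanishes for each pair of momenta separately. -/
theorem kernelS_eq_zero (hhbar : 0 < hbar) (halpha : 0 < alpha) (hlam : 0 < lam)
    (hχ : Integrable fun p => ‖χ p‖ ^ 2) {κ b₀ : ℝ}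
    (hsupp : ∀ p, hbar * κ < |p| → χ p = 0) {g : ℝ → ℂ} (hΦ : IsFourierPair Φ g)
    (hg : ∀ k, b₀ < |k| → g k = 0) {x y : ℝ}
    (hxy : 2 * b₀ + 2 * κ * couplingBeta alpha lam < lam * |y - x| / hbar) (b b' : ℝ) :
    kernelS hbar alpha lam χ Φ x y b b' = 0 := by
  set β := couplingBeta alpha lam with hβ
  have hβpos : 0 < β := by
    rw [hβ, couplingBeta]
    positivity
  have hw := integrable_weight hχ
  have hΦΦ : Integrable fun c => ((‖Φ c‖ ^ 2 : ℝ) : ℂ) :=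
    ((memLp_two_iff_integrable_sq_norm hΦ.memLp.1).1 hΦ.memLp).ofReal
  have hexp : ∀ c p p' : ℝ, Complex.exp (Complex.I / hbar * lam * (y - x) * c) *
      Complex.exp (-(Complex.I / hbar) * p * β * (b' - c : ℝ)) *
      Complex.exp (-(Complex.I / hbar) * p' * β * (c - b : ℝ)) =
      Complex.exp (-(Complex.I / hbar) * β * (p * b' - p' * b)) *
        Complex.exp (Complex.I * ((lam * (y - x) + (p - p') * β) / hbar : ℝ) * c) := fun c p p' => by
    rw [← Complex.exp_add, ← Complex.exp_add, ← Complex.exp_add]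
    congr 1
    push_cast
    ring
  have hstep : kernelS hbar alpha lam χ Φ x y b b' = ∫ c : ℝ, ∫ z : ℝ × ℝ,
      (((‖Φ c‖ ^ 2 : ℝ) : ℂ) * (((‖χ z.1‖ ^ 2 : ℝ) : ℂ) * ((‖χ z.2‖ ^ 2 : ℝ) : ℂ))) *
        (Complex.exp (-(Complex.I / hbar) * β * (z.1 * b' - z.2 * b)) *
        Complex.exp (Complex.I * ((lam * (y - x) + (z.1 - z.2) * β) / hbar : ℝ) * c))
        ∂(volume.prod volume) := by
    unfold kernelS kernelF
    refine integral_congr_ae (.of_forall fun c => ?_)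
    simp only
    rw [mul_assoc, ← integral_prod_mul, ← integral_const_mul]
    refine integral_congr_ae (.of_forall fun z => ?_)
    simp only
    rw [← hexp]
    ring
  have hcont : Continuous fun u : ℝ × ℝ × ℝ =>
      Complex.exp (-(Complex.I / hbar) * β * (u.2.1 * b' - u.2.2 * b)) *
        Complex.exp (Complex.I * ((lam * (y - x) + (u.2.1 - u.2.2) * β) / hbar : ℝ) * u.1) := by
    fun_prop
  have hint : Integrable (fun u : ℝ × ℝ × ℝ =>
      (((‖Φ u.1‖ ^ 2 : ℝ) : ℂ) * (((‖χ u.2.1‖ ^ 2 : ℝ) : ℂ) * ((‖χ u.2.2‖ ^ 2 : ℝ) : ℂ))) *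
      (Complex.exp (-(Complex.I / hbar) * β * (u.2.1 * b' - u.2.2 * b)) *
        Complex.exp (Complex.I * ((lam * (y - x) + (u.2.1 - u.2.2) * β) / hbar : ℝ) * u.1)))
      (volume.prod (volume.prod volume)) := by
    refine (hΦΦ.mul_prod (hw.mul_prod hw)).mul_bdd (c := 1) hcont.aestronglyMeasurable
      (.of_forall fun u => ?_)
    rw [norm_mul, norm_exp_of_re_eq_zero, norm_exp_of_re_eq_zero, one_mul]
    · rw [mul_assoc, ← Complex.ofReal_mul, mul_comm, Complex.re_ofReal_mul, Complex.I_re, mul_zero]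
    · rw [show -(Complex.I / hbar) * β * (u.2.1 * b' - u.2.2 * b) =
        ((-β * (u.2.1 * b' - u.2.2 * b) / hbar : ℝ) : ℂ) * Complex.I by push_cast; ring]
      simp
  rw [hstep, integral_integral_swap hint]
  refine integral_eq_zero_of_ae (.of_forall fun z => ?_)
  simp only [Pi.zero_apply]
  by_cases h1 : hbar * κ < |z.1|
  · simp [hsupp _ h1]
  by_cases h2 : hbar * κ < |z.2|
  · simp [hsupp _ h2]
  -- The momentum difference is at most `2ħκ`, so it lowers the frequency `λ|y - x|/ħ` by at most
  -- `2κβ`.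
  have hν : 2 * b₀ < |(lam * (y - x) + (z.1 - z.2) * β) / hbar| := by
    rw [not_lt] at h1 h2
    have h3 : |z.1 - z.2| ≤ 2 * (hbar * κ) := (abs_sub _ _).trans (by linarith)
    have h4 : lam * |y - x| - 2 * (hbar * κ) * β ≤ |lam * (y - x) + (z.1 - z.2) * β| := by
      have := abs_sub_abs_le_abs_sub (lam * (y - x)) (-((z.1 - z.2) * β))
      rw [sub_neg_eq_add, abs_neg, abs_mul, abs_mul, abs_of_pos hlam, abs_of_pos hβpos] at this
      nlinarith
    rw [abs_div, abs_of_pos hhbar, lt_div_iff₀ hhbar]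
    rw [lt_div_iff₀ hhbar] at hxy
    linarith
  have hzero := hΦ.integral_exp_mul_conj_eq_zero hΦ hg hg hν
  rw [← mul_zero (((‖χ z.1‖ ^ 2 : ℝ) : ℂ) * ((‖χ z.2‖ ^ 2 : ℝ) : ℂ) *
    Complex.exp (-(Complex.I / hbar) * β * (z.1 * b' - z.2 * b))), ← hzero, ← integral_const_mul]
  refine integral_congr_ae (.of_forall fun c => ?_)
  simp only
  have e1 : ((‖Φ c‖ ^ 2 : ℝ) : ℂ) = Φ c * (starRingEnd ℂ) (Φ c) := by
    rw [Complex.mul_conj, Complex.normSq_eq_norm_sq]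
  rw [e1]
  ring

end PointerStates

/-! ### Reduced state of system and pointer -/

section Decoherence

variable {hbar alpha lam : ℝ} {Ψ Φ g : ℝ → ℂ}

/-- The wave function `Ψ(k, q, b)` of the final state without the factor `Φ(b)`; here `x = a_k`
and `z = ⟨φ_k|ψ₀⟩`. -/
def probeFactor (hbar alpha lam : ℝ) (Ψ : ℝ → ℂ) (x : ℝ) (z : ℂ) (q b : ℝ) : ℂ :=
  Complex.exp (Complex.I / (2 * hbar) * alpha * couplingBeta alpha lam * x * b) *
    (Complex.exp (-(Complex.I / hbar) * alpha * x * q) *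
      (z * Ψ (q - couplingBeta alpha lam * b)))

theorem finalState_eq {N : ℕ} (a : Fin N → ℝ) (c : Fin N → ℂ) (k : Fin N) (q : ℝ) :
    finalState hbar alpha lam a c Ψ Φ k q =
      fun b => probeFactor hbar alpha lam Ψ (a k) (c k) q b * Φ b := by
  funext b
  simp only [finalState, evolAB, evolAQ, evolPB, probeFactor]
  ring

theorem norm_probeFactor (x : ℝ) (z : ℂ) (q b : ℝ) :
    ‖probeFactor hbar alpha lam Ψ x z q b‖ = ‖z‖ * ‖Ψ (q - couplingBeta alpha lam * b)‖ := by
  rw [probeFactor, norm_mul, norm_mul, norm_mul, norm_exp_of_re_eq_zero, norm_exp_of_re_eq_zero,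
    one_mul, one_mul]
  · rw [show -(Complex.I / hbar) * alpha * x * q =
      ((-(alpha * x * q) / hbar : ℝ) : ℂ) * Complex.I by push_cast; ring]
    simp
  · rw [show Complex.I / (2 * hbar) * alpha * couplingBeta alpha lam * x * b =
      ((alpha * couplingBeta alpha lam * x * b / (2 * hbar) : ℝ) : ℂ) * Complex.I by
        push_cast; ring, Complex.re_ofReal_mul, Complex.I_re, mul_zero]

/-- The phases have modulus one, and translation by `βb` does not change `∫ |Ψ|²`, which gives a
bound uniform in `b`. -/
theorem isWeightedFamily_probeFactor (hΨ : IsFourierPair Ψ g) (x : ℝ) (z : ℂ) :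
    IsWeightedFamily (fun _ => 1) (probeFactor hbar alpha lam Ψ x z) (‖z‖ * ∫ k, ‖g k‖)
      (‖z‖ ^ 2 * ∫ q, ‖Ψ q‖ ^ 2) := by
  have hΨ2 := (memLp_two_iff_integrable_sq_norm hΨ.memLp.1).1 hΨ.memLp
  have hc := hΨ.continuous
  refine ⟨aestronglyMeasurable_const, by unfold probeFactor; fun_prop, fun s b => ?_,
    fun b => ?_, fun b => ?_⟩
  · rw [norm_probeFactor]
    exact mul_le_mul_of_nonneg_left (hΨ.norm_le _) (norm_nonneg _)
  · simp only [norm_probeFactor, norm_one, one_mul, mul_pow]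
    exact (hΨ2.comp_sub_right _).const_mul _
  · simp only [norm_probeFactor, norm_one, one_mul, mul_pow]
    rw [integral_const_mul, integral_sub_right_eq_self (fun q => ‖Ψ q‖ ^ 2)]

theorem integral_probeFactor (halpha : alpha ≠ 0) (x y : ℝ) (z z' : ℂ) (b b' : ℝ) :
    ∫ q, (1 : ℂ) * probeFactor hbar alpha lam Ψ x z q b *
        (starRingEnd ℂ) (probeFactor hbar alpha lam Ψ y z' q b') =
      z * (starRingEnd ℂ) z' * Complex.exp (Complex.I / hbar * lam * (x * b - y * b')) *
        kernelI hbar alpha lam Ψ x y b b' := by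
  unfold kernelI
  rw [← integral_const_mul]
  refine integral_congr_ae (.of_forall fun q => ?_)
  simp only [probeFactor, map_mul, ← Complex.exp_conj, Complex.conj_I, Complex.conj_ofReal,
    map_div₀, map_neg, map_ofNat]
  -- The choice of `β` turns the phase `αβxb/(2ħ)` into `λxb/ħ`, the phase occurring in the pointer
  -- state.
  have hβ : (alpha : ℂ) * (couplingBeta alpha lam : ℂ) = 2 * lam := by
    rw [← Complex.ofReal_mul, couplingBeta, mul_div_cancel₀ _ halpha]
    push_cast
    ring
  have e : Complex.exp (Complex.I / (2 * hbar) * alpha * couplingBeta alpha lam * x * b) *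
      Complex.exp (-(Complex.I / hbar) * alpha * x * q) *
      (Complex.exp (-Complex.I / (2 * hbar) * alpha * couplingBeta alpha lam * y * b') *
      Complex.exp (-(-Complex.I / hbar) * alpha * y * q)) =
      Complex.exp (Complex.I / hbar * lam * (x * b - y * b')) *
      Complex.exp (-(Complex.I / hbar) * alpha * q * (x - y)) := by
    rw [← Complex.exp_add, ← Complex.exp_add, ← Complex.exp_add, ← Complex.exp_add]
    congr 1
    have h2 : Complex.I / (2 * (hbar : ℂ)) = Complex.I / hbar / 2 := by
      rw [mul_comm, div_mul_eq_div_div]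
    have h3 : -Complex.I / (2 * (hbar : ℂ)) = -(Complex.I / hbar / 2) := by
      rw [neg_div, h2]
    rw [h2, h3]
    linear_combination (Complex.I / hbar / 2 * (x * b - y * b')) * hβ
  linear_combination (z * (starRingEnd ℂ) z' * Ψ (q - couplingBeta alpha lam * b) *
    (starRingEnd ℂ) (Ψ (q - couplingBeta alpha lam * b'))) * e

theorem kernelI_eq_zero (hhbar : 0 < hbar) (halpha : 0 < alpha) (hΨ : IsFourierPair Ψ g) {κ : ℝ}
    (hg : ∀ k, κ < |k| → g k = 0) {x y : ℝ} (hxy : 2 * κ < alpha * |x - y| / hbar) (b b' : ℝ) :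
    kernelI hbar alpha lam Ψ x y b b' = 0 := by
  set β := couplingBeta alpha lam
  have hs : ∀ s k : ℝ, κ < |k| → Complex.exp (-Complex.I * s * k) * g k = 0 := fun s k hk => by
    rw [hg k hk, mul_zero]
  have h := (hΨ.comp_sub (β * b)).integral_exp_mul_conj_eq_zero (hΨ.comp_sub (β * b')) (hs _)
    (hs _) (ν := -(alpha * (x - y) / hbar)) (by
      rwa [abs_neg, abs_div, abs_mul, abs_of_pos halpha, abs_of_pos hhbar])
  rw [← h]
  unfold kernelI
  refine integral_congr_ae (.of_forall fun q => ?_)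
  simp only
  congr 3
  push_cast
  ring

/-- Substitution `p = ħk`: the Jacobian `ħ` cancels against the normalisation `2π/ħ` and leaves the
`2π` of Parseval's identity. -/
theorem integral_momentumAmplitude (hhbar : 0 < hbar) (f : ℝ → ℂ) :
    ∫ p : ℝ, ((‖momentumAmplitude hbar g p‖ ^ 2 : ℝ) : ℂ) * f (p / hbar) =
      2 * Real.pi * ∫ k : ℝ, ((‖g k‖ ^ 2 : ℝ) : ℂ) * f k := by
  have e : ∀ p : ℝ, ((‖momentumAmplitude hbar g p‖ ^ 2 : ℝ) : ℂ) * f (p / hbar) =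
      (2 * Real.pi / hbar : ℂ) * (fun k => ((‖g k‖ ^ 2 : ℝ) : ℂ) * f k) (p / hbar) := fun p => by
    rw [momentumAmplitude, norm_mul, mul_pow, Complex.norm_real,
      Real.norm_of_nonneg (Real.sqrt_nonneg _), Real.sq_sqrt (by positivity)]
    push_cast
    ring
  simp only [e]
  rw [integral_const_mul, Measure.integral_comp_div (fun k => ((‖g k‖ ^ 2 : ℝ) : ℂ) * f k),
    abs_of_pos hhbar, Complex.real_smul]
  have : (hbar : ℂ) ≠ 0 := by exact_mod_cast hhbar.ne'
  field_simp

/-- For equal eigenvalues the oscillating factor disappears and `I` is an overlap of two translates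
of `Ψ`. In momentum space translations are phases, so Parseval yields `F`. -/
theorem kernelI_self (hhbar : 0 < hbar) (hΨ : IsFourierPair Ψ g) (x b b' : ℝ) :
    kernelI hbar alpha lam Ψ x x b b' =
      kernelF hbar alpha lam (momentumAmplitude hbar g) (b - b') := by
  set β := couplingBeta alpha lam with hβ
  have h1 : kernelI hbar alpha lam Ψ x x b b' =
      ∫ q, Ψ (q - β * b) * (starRingEnd ℂ) (Ψ (q - β * b')) := by
    unfold kernelI
    refine integral_congr_ae (.of_forall fun q => ?_)
    simp [hβ]
  rw [h1, (hΨ.comp_sub (β * b)).integral_mul_conj (hΨ.comp_sub (β * b'))]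
  have h2 := integral_momentumAmplitude (g := g) hhbar
    fun k => Complex.exp (-Complex.I * k * β * (b - b' : ℝ))
  have h3 : kernelF hbar alpha lam (momentumAmplitude hbar g) (b - b') =
      ∫ p : ℝ, ((‖momentumAmplitude hbar g p‖ ^ 2 : ℝ) : ℂ) *
        Complex.exp (-Complex.I * (p / hbar : ℝ) * β * (b - b' : ℝ)) := by
    unfold kernelF
    refine integral_congr_ae (.of_forall fun p => ?_)
    simp only
    congr 2
    push_cast
    ring
  rw [h3, h2]
  congr 1
  refine integral_congr_ae (.of_forall fun k => ?_)
  simp only [map_mul, ← Complex.exp_conj, Complex.conj_I, Complex.conj_ofReal, map_neg]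
  rw [mul_mul_mul_comm, ← Complex.exp_add, Complex.mul_conj, Complex.normSq_eq_norm_sq, mul_comm]
  congr 2
  push_cast
  ring

theorem integrable_momentumAmplitude_sq (hhbar : 0 < hbar) (hg : MemLp g 2) :
    Integrable fun p => ‖momentumAmplitude hbar g p‖ ^ 2 := by
  have h := (((memLp_two_iff_integrable_sq_norm hg.1).1 hg).comp_div hhbar.ne').const_mul
    (Real.sqrt (2 * Real.pi / hbar) ^ 2)
  refine h.congr (.of_forall fun p => ?_)
  simp only
  rw [momentumAmplitude, norm_mul, mul_pow, Complex.norm_real,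
    Real.norm_of_nonneg (Real.sqrt_nonneg _)]

/-- The operator `∫ dq |Ψ(k, q, ·)⟩⟨Ψ(l, q, ·)|` on the pointer space. -/
def coherenceBlock (hbar alpha lam : ℝ) (Ψ Φ : ℝ → ℂ) (x y : ℝ) (z z' : ℂ) :
    PointerSpace →L[ℂ] PointerSpace :=
  ∫ q, InnerProductSpace.rankOne ℂ (toL2 fun b => probeFactor hbar alpha lam Ψ x z q b * Φ b)
    (toL2 fun b => probeFactor hbar alpha lam Ψ y z' q b * Φ b)

theorem hasKernel_coherenceBlock (halpha : alpha ≠ 0) (hΨ : IsFourierPair Ψ g) (hΦ : MemLp Φ 2)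
    (x y : ℝ) (z z' : ℂ) :
    HasKernel (coherenceBlock hbar alpha lam Ψ Φ x y z z') fun b b' =>
      Φ b * (starRingEnd ℂ) (Φ b') *
        (z * (starRingEnd ℂ) z' * Complex.exp (Complex.I / hbar * lam * (x * b - y * b')) *
        kernelI hbar alpha lam Ψ x y b b') := by
  have h := (isWeightedFamily_probeFactor (hbar := hbar) (alpha := alpha) (lam := lam)
    hΨ x z).hasKernel (isWeightedFamily_probeFactor (hbar := hbar) (alpha := alpha) (lam := lam)
      hΨ y z') hΦ
  simp only [integral_probeFactor halpha, one_smul] at h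
  exact h

theorem coherenceBlock_eq_zero (halpha : alpha ≠ 0) (hΨ : IsFourierPair Ψ g) (hΦ : MemLp Φ 2)
    {x y : ℝ} (hI : ∀ b b', kernelI hbar alpha lam Ψ x y b b' = 0) (z z' : ℂ) :
    coherenceBlock hbar alpha lam Ψ Φ x y z z' = 0 := by
  have h := hasKernel_coherenceBlock (hbar := hbar) (lam := lam) halpha hΨ hΦ x y z z'
  simp only [hI, mul_zero] at h
  exact h.unique HasKernel.zero

theorem coherenceBlock_self (hhbar : 0 < hbar) (halpha : alpha ≠ 0) (hΨ : IsFourierPair Ψ g)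
    (hΦ : MemLp Φ 2) (x : ℝ) (z : ℂ) :
    coherenceBlock hbar alpha lam Ψ Φ x x z z =
      ((‖z‖ ^ 2 : ℝ) : ℂ) • pointerState hbar alpha lam (momentumAmplitude hbar g) Φ x := by
  refine (hasKernel_coherenceBlock halpha hΨ hΦ x x z z).unique ?_
  have hχ := integrable_momentumAmplitude_sq hhbar hΨ.memLp_amplitude
  convert! (hasKernel_pointerState (hbar := hbar) (alpha := alpha) (lam := lam) hχ hΦ x).const_smul
    ((‖z‖ ^ 2 : ℝ) : ℂ) using 3 with b b'
  rw [kernelI_self hhbar hΨ, Complex.mul_conj, Complex.normSq_eq_norm_sq, ← mul_sub]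
  ring_nf

theorem integrable_coherenceBlock (hΨ : IsFourierPair Ψ g) (hΦ : MemLp Φ 2)
    (x y : ℝ) (z z' : ℂ) :
    Integrable fun q => InnerProductSpace.rankOne ℂ
      (toL2 fun b => probeFactor hbar alpha lam Ψ x z q b * Φ b)
      (toL2 fun b => probeFactor hbar alpha lam Ψ y z' q b * Φ b) := by
  have h := (isWeightedFamily_probeFactor (hbar := hbar) (alpha := alpha) (lam := lam)
    hΨ x z).integrable_rankOne (isWeightedFamily_probeFactor (hbar := hbar)
      (alpha := alpha) (lam := lam) hΨ y z') hΦ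
  simp only [one_smul] at h
  exact h

/-- Evaluation at `v` and projection to the component `k` are continuous and linear, so they pass
through the integral over `q`; the inner product in the direct sum splits into the blocks. -/
theorem traceProbe_finalState_apply {N : ℕ} (hΨ : IsFourierPair Ψ g) (hΦ : MemLp Φ 2)
    (a : Fin N → ℝ) (c : Fin N → ℂ) (v : SystemPointerSpace N) (k : Fin N) :
    traceProbe (finalState hbar alpha lam a c Ψ Φ) v k =
      ∑ l, coherenceBlock hbar alpha lam Ψ Φ (a k) (a l) (c k) (c l) (v l) := by
  have hfam := fun l : Fin N => isWeightedFamily_probeFactor (hbar := hbar) (alpha := alpha)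
    (lam := lam) hΨ (a l) (c l)
  set V : ℝ → SystemPointerSpace N := fun q =>
    WithLp.toLp 2 fun k => toL2 (finalState hbar alpha lam a c Ψ Φ k q) with hV
  have hVk : ∀ q k, V q k =
      toL2 fun b => probeFactor hbar alpha lam Ψ (a k) (c k) q b * Φ b := fun q k => by
    simp only [hV, finalState_eq]
  have hVc : Continuous V := by
    refine (PiLp.continuous_toLp 2 _).comp (continuous_pi fun k => ?_)
    simp only [finalState_eq]
    exact (hfam k).continuous_toL2 hΦ
  have hint : Integrable fun q => InnerProductSpace.rankOne ℂ (V q) (V q) := by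
    have hsum : Integrable fun q => ∑ k, ‖V q k‖ ^ 2 := by
      refine integrable_finsetSum _ fun k _ => ?_
      simp only [hVk]
      simpa using (hfam k).integrable_mul_norm_toL2_sq hΦ
    refine hsum.mono' (aestronglyMeasurable_rankOne hVc hVc) (.of_forall fun q => ?_)
    rw [InnerProductSpace.norm_rankOne, ← sq, PiLp.norm_sq_eq_of_L2]
  have h1 : traceProbe (finalState hbar alpha lam a c Ψ Φ) v k =
      ∫ q, (InnerProductSpace.rankOne ℂ (V q) (V q) v) k := by
    have := ((PiLp.proj 2 (fun _ : Fin N => PointerSpace) k : SystemPointerSpace N →L[ℂ] _).comp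
      (ContinuousLinearMap.apply ℂ (SystemPointerSpace N) v)).integral_comp_comm hint
    exact this.symm
  rw [h1]
  have h2 : ∀ q, (InnerProductSpace.rankOne ℂ (V q) (V q) v) k = ∑ l,
      InnerProductSpace.rankOne ℂ
        (toL2 fun b => probeFactor hbar alpha lam Ψ (a k) (c k) q b * Φ b)
        (toL2 fun b => probeFactor hbar alpha lam Ψ (a l) (c l) q b * Φ b) (v l) := fun q => by
    rw [InnerProductSpace.rankOne_apply, PiLp.smul_apply, PiLp.inner_apply, Finset.sum_smul]
    simp only [InnerProductSpace.rankOne_apply, hVk]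
  simp only [h2]
  have hT := fun l => integrable_coherenceBlock (hbar := hbar) (alpha := alpha) (lam := lam) hΨ hΦ
    (a k) (a l) (c k) (c l)
  rw [integral_finsetSum]
  swap
  · exact fun l _ => (ContinuousLinearMap.apply ℂ PointerSpace (v l)).integrable_comp (hT l)
  refine Finset.sum_congr rfl fun l _ => ?_
  exact (ContinuousLinearMap.integral_apply (hT l) (v l)).symm

end Decoherence

/-! ### Coupling thresholds and the main theorem -/

theorem alphaD_lt_alphaZero {hbar κ₀ b₀ a₀ lam : ℝ} (hhbar : 0 < hbar) (hκ₀ : 0 < κ₀)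
    (hb₀ : 0 < b₀) (ha₀ : 0 < a₀) (hlam : 0 < lam) (h : lambdaZero hbar b₀ a₀ < lam) :
    0 < a₀ - 2 * hbar * b₀ / lam ∧ alphaD hbar κ₀ a₀ < alphaZero hbar κ₀ b₀ a₀ lam := by
  have h1 : 0 < a₀ - 2 * hbar * b₀ / lam := by
    rw [lambdaZero, div_lt_iff₀ ha₀] at h
    rw [sub_pos, div_lt_iff₀ hlam]
    linarith
  refine ⟨h1, ?_⟩
  have h2 : 0 < 2 * hbar * b₀ / lam := by positivity
  have h3 : 0 < hbar * κ₀ := mul_pos hhbar hκ₀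
  rw [alphaD, alphaZero, div_lt_div_iff₀ ha₀ h1]
  nlinarith

end

theorem mainTheorem3
    {H : Type*} [NormedAddCommGroup H] [InnerProductSpace ℂ H] {N : ℕ}
    -- the system: a nondegenerate observable `A` with eigenbasis `φ`, and an initial state `ψ₀`
    (A : H →ₗ[ℂ] H) (φ : OrthonormalBasis (Fin N) ℂ H) (a : Fin N → ℝ)
    (hA : ∀ k, A (φ k) = (a k : ℂ) • φ k) (ha : Function.Injective a)
    (a₀ : ℝ) (ha₀ : IsLeast {d : ℝ | ∃ k l, a l < a k ∧ d = a k - a l} a₀)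
    (ψ₀ : H) (hψ₀ : ‖ψ₀‖ = 1)
    (hbar κ₀ b₀ alpha lam : ℝ) (hhbar : 0 < hbar) (hκ₀ : 0 < κ₀) (hb₀ : 0 < b₀)
    (halpha : 0 < alpha) (hlam : 0 < lam)
    -- the probe: momentum limited, with real momentum amplitude of definite parity
    (Ψ g : ℝ → ℂ) (hΨ : HasSpectralAmplitude κ₀ Ψ g) (hΨ_norm : ∫ q : ℝ, ‖Ψ q‖ ^ 2 = 1)
    (hreal : ∀ᵐ p : ℝ, (momentumAmplitude hbar g p).im = 0)
    (hparity : (∀ᵐ p : ℝ, momentumAmplitude hbar g (-p) = momentumAmplitude hbar g p) ∨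
      (∀ᵐ p : ℝ, momentumAmplitude hbar g (-p) = -momentumAmplitude hbar g p))
    -- the pointer: momentum limited
    (Φ : ℝ → ℂ) (hΦ : IsMomentumLimited b₀ Φ) (hΦ_norm : ∫ b : ℝ, ‖Φ b‖ ^ 2 = 1) :
    let χ : ℝ → ℂ := momentumAmplitude hbar g
    let ρ : Fin N → PointerSpace →L[ℂ] PointerSpace := fun k =>
      pointerState hbar alpha lam χ Φ (a k)
    -- the kernels `S_{kl}` give the products of the pointer states
    (∀ k l, k ≠ l → HasKernel (ρ k * ρ l) fun b b' =>
      Complex.exp (Complex.I / hbar * lam * (a k * b - a l * b')) * Φ b *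
        (starRingEnd ℂ) (Φ b') * kernelS hbar alpha lam χ Φ (a k) (a l) b b') ∧
    (lambdaZero hbar b₀ a₀ < lam → alphaD hbar κ₀ a₀ < alphaZero hbar κ₀ b₀ a₀ lam) ∧
    (lambdaZero hbar b₀ a₀ < lam → alphaZero hbar κ₀ b₀ a₀ lam < alpha →
      -- orthogonality
      (∀ k l, k ≠ l → ∀ b b', kernelS hbar alpha lam χ Φ (a k) (a l) b b' = 0) ∧
      (∀ k l, k ≠ l → ρ k * ρ l = 0) ∧
      -- the orthogonal decomposition into supports and the projection valued measure
      (∀ i j, i ≠ j → supportSpace ρ i ⟂ supportSpace ρ j) ∧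
      DirectSum.IsInternal (supportSpace ρ) ∧
      (∃ E : Option (Fin N) → PointerSpace →L[ℂ] PointerSpace,
        IsProjectionValuedMeasure E ∧
        (∀ i, LinearMap.range (E i).toLinearMap = supportSpace ρ i) ∧
        (∀ k, E (some k) * ρ k = ρ k) ∧
        (∀ i k, i ≠ some k → E i * ρ k = 0)) ∧
      -- exact decoherence
      alphaD hbar κ₀ a₀ < alpha ∧
      (∀ k l, k ≠ l → ∀ b b', kernelI hbar alpha lam Ψ (a k) (a l) b b' = 0) ∧
      (∀ v : SystemPointerSpace N, ∀ k,
        traceProbe (finalState hbar alpha lam a (fun k => inner ℂ (φ k) ψ₀) Ψ Φ) v k =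
          ((‖inner ℂ (φ k) ψ₀‖ ^ 2 : ℝ) : ℂ) • ρ k (v k))) := by
  intro χ ρ
  have hΨ' := hΨ.isFourierPair hκ₀
  obtain ⟨G, hG⟩ := hΦ
  have hΦ' := hG.isFourierPair hb₀
  have hχ : Integrable fun p => ‖χ p‖ ^ 2 :=
    integrable_momentumAmplitude_sq hhbar hΨ'.memLp_amplitude
  have heven : ∀ᵐ p : ℝ, ‖χ (-p)‖ = ‖χ p‖ := by
    rcases hparity with h | h
    · filter_upwards [h] with p hp
      simp only [χ, hp]
    · filter_upwards [h] with p hp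
      simp only [χ, hp, norm_neg]
  have hsupp : ∀ p, hbar * κ₀ < |p| → χ p = 0 := fun p hp => by
    have : g (p / hbar) = 0 := hΨ.2.2.1 _ (by
      rwa [abs_div, abs_of_pos hhbar, lt_div_iff₀ hhbar, mul_comm])
    simp only [χ, momentumAmplitude, this, mul_zero]
  have ha₀pos : 0 < a₀ := by
    obtain ⟨k, l, hkl, rfl⟩ := ha₀.1
    linarith
  have hgap : ∀ k l, k ≠ l → a₀ ≤ |a k - a l| := fun k l hkl => by
    rcases lt_or_gt_of_ne (ha.ne hkl) with h | h
    · rw [abs_sub_comm]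
      exact (ha₀.2 ⟨l, k, h, rfl⟩).trans (le_abs_self _)
    · exact (ha₀.2 ⟨k, l, h, rfl⟩).trans (le_abs_self _)
  have hker : ∀ k l, HasKernel (ρ k * ρ l) fun b b' =>
      Complex.exp (Complex.I / hbar * lam * (a k * b - a l * b')) * Φ b *
        (starRingEnd ℂ) (Φ b') * kernelS hbar alpha lam χ Φ (a k) (a l) b b' := fun k l =>
    hasKernel_pointerState_mul hχ hΦ'.memLp heven _ _
  refine ⟨fun k l _ => hker k l,
    fun h => (alphaD_lt_alphaZero hhbar hκ₀ hb₀ ha₀pos hlam h).2, fun h h' => ?_⟩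
  obtain ⟨hpos, hDZ⟩ := alphaD_lt_alphaZero hhbar hκ₀ hb₀ ha₀pos hlam h
  have hD := hDZ.trans h'
  have hS : ∀ k l, k ≠ l → ∀ b b', kernelS hbar alpha lam χ Φ (a k) (a l) b b' = 0 := by
    intro k l hkl
    refine kernelS_eq_zero hhbar halpha hlam hχ hsupp hΦ' hG.2.2.1 ?_
    have h1 := hgap l k hkl.symm
    rw [alphaZero, div_lt_iff₀ hpos] at h'
    refine lt_of_lt_of_le ?_ (div_le_div_of_nonneg_right
      (mul_le_mul_of_nonneg_left h1 hlam.le) hhbar.le)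
    -- With `β = 2λ/α` the frequency margin is a positive multiple of `α(a₀ - 2ħb₀/λ) - 4ħκ₀`, whose
    -- positivity is the condition `α > α₀`.
    have h2 : lam * a₀ / hbar - (2 * b₀ + 2 * κ₀ * couplingBeta alpha lam) =
        lam / (hbar * alpha) *
          (alpha * (a₀ - 2 * hbar * b₀ / lam) - 4 * hbar * κ₀) := by
      rw [couplingBeta]
      field_simp
      ring
    have h3 : 0 < lam / (hbar * alpha) *
        (alpha * (a₀ - 2 * hbar * b₀ / lam) - 4 * hbar * κ₀) :=
      mul_pos (by positivity) (by linarith)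
    linarith
  have horth : ∀ k l, k ≠ l → ρ k * ρ l = 0 := fun k l hkl => by
    have := hker k l
    simp only [hS k l hkl, mul_zero] at this
    exact this.unique HasKernel.zero
  have hsa : ∀ k, IsSelfAdjoint (ρ k) := fun k => isSelfAdjoint_pointerState _
  have hI : ∀ k l, k ≠ l → ∀ b b', kernelI hbar alpha lam Ψ (a k) (a l) b b' = 0 := by
    intro k l hkl
    refine kernelI_eq_zero hhbar halpha hΨ' hΨ.2.2.1 ?_
    rw [alphaD, div_lt_iff₀ ha₀pos] at hD
    rw [lt_div_iff₀ hhbar]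
    have := mul_le_mul_of_nonneg_left (hgap k l hkl) halpha.le
    linarith
  refine ⟨hS, horth, supportSpace_isOrtho hsa horth, isInternal_supportSpace hsa horth,
    exists_projectionValuedMeasure hsa horth, hD, hI, fun v k => ?_⟩
  rw [traceProbe_finalState_apply hΨ' hΦ'.memLp, Finset.sum_eq_single k]
  · rw [coherenceBlock_self hhbar halpha.ne' hΨ' hΦ'.memLp]
    rfl
  · intro l _ hlk
    rw [coherenceBlock_eq_zero halpha.ne' hΨ' hΦ'.memLp (hI k l hlk.symm)]
    rfl
  · exact fun hk => absurd (Finset.mem_univ k) hk
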